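/- Let $d\ge 1$, $\hat\kappa=(-1,1)^d\subset\mathbb{R}^d$ and let $p,l\ge 0$ be integers. Let $\mathcal P_p(\hat\kappa)$ be the space of real polynomials in $d$ variables of total degree at most $p$, and let $\Pi_{\mathcal P_p}$ be the $L^2(\hat\kappa)$-orthogonal projection onto $\mathcal P_p(\hat\kappa)$. For real $m\ge n\ge 0$ put $$\Phi_d(m,n)=\left(\frac{\Gamma\left(\frac{m-n}{d}+1\right)}{\Gamma\left(\frac{m+n}{d}+1\right)}\right)^{d},$$ and for $u\in H^s(\hat\kappa)$ with weak derivatives $D^\alpha u$ put $$|u|_{H^s(\hat\kappa)}^2=\sum_{|\alpha|=s}\|D^\alpha u\|_{L^2(\hat\kappa)}^2,\qquad |u|_{V^s(\hat\kappa)}^2=\sum_{|\alpha|=s}\|W^\alpha D^\alpha u\|_{L^2(\hat\kappa)}^2,\qquad W^\alpha(x)=\prod_{k=1}^d(1-x_k^2)^{\alpha_k/2},$$ where the sums run over all multi-indices $\alpha\in\mathbb{N}_0^d$ with $|\alpha|=\alpha_1+\dots+\alpha_d=s$. Theorem. For every integer $s\ge 0$ there is a constant $C(s)>0$, depending only on $s$,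 such that for all integers $d\ge 1$ and $p,l\ge 0$ with $0\le s\le\min\{p+1,l\}$ and all $u\in H^l(\hat\kappa)$, $$\|u-\Pi_{\mathcal P_p}u\|_{L^2(\hat\kappa)}^2\le\Phi_d(p+1,s)\,|u|_{V^s(\hat\kappa)}^2\le C(s)\left(\frac{d}{p+1}\right)^{2s}|u|_{H^s(\hat\kappa)}^2 .$$ -/

import Mathlib

open MeasureTheory

noncomputable section

namespace CubeProj

/-- The reference element `(-1,1)^d`, as an open subset of `ℝ^d` (with Lebesgue measure). -/
def cube (d : ℕ) : TopologicalSpace.Opens (Fin d → ℝ) :=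
  ⟨Set.univ.pi fun _ => Set.Ioo (-1) 1, isOpen_set_pi Set.finite_univ fun _ _ => isOpen_Ioo⟩

/-- Lebesgue measure on `(-1,1)^d`. -/
abbrev cubeMeasure (d : ℕ) : Measure (Fin d → ℝ) := volume.restrict (cube d : Set (Fin d → ℝ))

/-- The Hilbert space `L²((-1,1)^d)` of real-valued functions. -/
abbrev L2Cube (d : ℕ) : Type := Lp ℝ 2 (cubeMeasure d)

/-! ### Sobolev spaces and seminorms -/

/-- The classical partial derivative `∂f/∂x_k`. -/
def partialDeriv {d : ℕ} (k : Fin d) (f : (Fin d → ℝ) → ℝ) : (Fin d → ℝ) → ℝ :=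
  fun x => fderiv ℝ f x (Pi.single k 1)

/-- The classical mixed derivative `∂_1^{α_1} ⋯ ∂_d^{α_d} f`. -/
def mixedDeriv {d : ℕ} (α : Fin d → ℕ) (f : (Fin d → ℝ) → ℝ) : (Fin d → ℝ) → ℝ :=
  (List.finRange d).foldr (fun k g => (partialDeriv k)^[α k] g) f

/-- `v` is a weak derivative `D^α u` on `(-1,1)^d`. The test functions `φ` are the smooth functions
with compact support in the open cube. -/
structure IsWeakDeriv {d : ℕ} (α : Fin d → ℕ) (u v : (Fin d → ℝ) → ℝ) : Prop where
  locallyIntegrableOn_left : LocallyIntegrableOn u (cube d : Set (Fin d → ℝ)) volume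
  locallyIntegrableOn_right : LocallyIntegrableOn v (cube d : Set (Fin d → ℝ)) volume
  integral_eq : ∀ φ : TestFunction (cube d) ℝ ⊤,
    ∫ x in (cube d : Set (Fin d → ℝ)), u x * mixedDeriv α φ x =
      (-1) ^ (∑ k, α k) * ∫ x in (cube d : Set (Fin d → ℝ)), v x * φ x

open Classical in
/-- The weak derivative `D^α u` on `(-1,1)^d` (unique almost everywhere; `0` if there is none). -/
def weakDeriv {d : ℕ} (α : Fin d → ℕ) (u : (Fin d → ℝ) → ℝ) : (Fin d → ℝ) → ℝ :=
  if h : ∃ v, IsWeakDeriv α u v then h.choose else 0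

/-- `u ∈ H^l((-1,1)^d)`: `u` and all its weak derivatives of order at most `l` exist in `L²`. -/
def MemSobolev {d : ℕ} (l : ℕ) (u : (Fin d → ℝ) → ℝ) : Prop :=
  MemLp u 2 (cubeMeasure d) ∧
    ∀ α : Fin d → ℕ, ∑ k, α k ≤ l → ∃ v, IsWeakDeriv α u v ∧ MemLp v 2 (cubeMeasure d)

/-- The weight `W^α(x) = ∏_k ((1 - x_k²)^{1/2})^{α_k}`. -/
def weight {d : ℕ} (α : Fin d → ℕ) (x : Fin d → ℝ) : ℝ :=
  ∏ k, Real.sqrt (1 - x k ^ 2) ^ α k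

/-- The Sobolev seminorm `|u|_{H^s} = (∑_{|α| = s} ‖D^α u‖²_{L²})^{1/2}` on `(-1,1)^d`;
`Finset.univ.piAntidiag s` is the set of all multi-indices `α` with `|α| = s`. -/
def seminormH {d : ℕ} (s : ℕ) (u : (Fin d → ℝ) → ℝ) : ℝ :=
  Real.sqrt (∑ α ∈ (Finset.univ : Finset (Fin d)).piAntidiag s,
    ∫ x in (cube d : Set (Fin d → ℝ)), weakDeriv α u x ^ 2)

/-- The Jacobi-weighted seminorm `|u|_{V^s} = (∑_{|α| = s} ‖W^α D^α u‖²_{L²})^{1/2}`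
on `(-1,1)^d`. -/
def seminormV {d : ℕ} (s : ℕ) (u : (Fin d → ℝ) → ℝ) : ℝ :=
  Real.sqrt (∑ α ∈ (Finset.univ : Finset (Fin d)).piAntidiag s,
    ∫ x in (cube d : Set (Fin d → ℝ)), (weight α x * weakDeriv α u x) ^ 2)

/-! ### Polynomials in `L²` and the orthogonal projection -/

theorem memLp_polynomial {d : ℕ} (q : MvPolynomial (Fin d) ℝ) :
    MemLp (fun x => MvPolynomial.eval x q) 2 (cubeMeasure d) := by
  have hc : Continuous fun x : Fin d → ℝ => MvPolynomial.eval x q := MvPolynomial.continuous_eval q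
  have hsub : (cube d : Set (Fin d → ℝ)) ⊆ Set.Icc (fun _ => -1) (fun _ => 1) := fun x hx =>
    ⟨fun k => (hx k (Set.mem_univ k)).1.le, fun k => (hx k (Set.mem_univ k)).2.le⟩
  have hK : IsCompact (Set.Icc (fun _ : Fin d => (-1 : ℝ)) (fun _ => 1)) := isCompact_Icc
  have : MemLp (fun x => MvPolynomial.eval x q) 2
      (volume.restrict (Set.Icc (fun _ : Fin d => (-1 : ℝ)) (fun _ => 1))) := by
    obtain ⟨C, hC⟩ := hK.exists_bound_of_continuousOn hc.continuousOn
    have : IsFiniteMeasure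
        (volume.restrict (Set.Icc (fun _ : Fin d => (-1 : ℝ)) (fun _ => 1))) :=
      ⟨by simpa using hK.measure_lt_top⟩
    exact MemLp.of_bound hc.aestronglyMeasurable C
      (ae_restrict_of_forall_mem measurableSet_Icc hC)
  exact this.mono_measure (Measure.restrict_mono hsub le_rfl)

/-- A polynomial in `d` variables, as an element of `L²((-1,1)^d)`. -/
def polyToL2 (d : ℕ) : MvPolynomial (Fin d) ℝ →ₗ[ℝ] L2Cube d where
  toFun q := (memLp_polynomial q).toLp _
  map_add' q r := by
    rw [← MemLp.toLp_add]
    congr 1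
    ext x
    simp
  map_smul' c q := by
    rw [RingHom.id_apply, ← MemLp.toLp_const_smul]
    congr 1
    ext x
    simp

/-- The space `P_p` of polynomials of total degree at most `p`, as a subspace of `L²`. -/
def polySpace (d p : ℕ) : Submodule ℝ (L2Cube d) :=
  (MvPolynomial.restrictTotalDegree (Fin d) ℝ p).map (polyToL2 d)

instance (d p : ℕ) : FiniteDimensional ℝ (polySpace d p) := by
  unfold polySpace
  infer_instance

/-- The `L²`-orthogonal projection `Π_{P_p}` of `L²((-1,1)^d)` onto `P_p`. -/
def projP (d p : ℕ) : L2Cube d →L[ℝ] L2Cube d := (polySpace d p).starProjection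

/-- `Φ_d(m,n) = (Γ((m-n)/d + 1) / Γ((m+n)/d + 1))^d`. -/
def Phi (d : ℕ) (m n : ℝ) : ℝ :=
  (Real.Gamma ((m - n) / d + 1) / Real.Gamma ((m + n) / d + 1)) ^ d

end CubeProj

end

/-! Expand `u` in tensor Legendre polynomials `L_β = ∏ L_{β_k}(x_k)`, an orthogonal basis of `L²`
adapted to total degree. By Parseval the squared projection error is the sum of the energies `a_β =
⟨L_β, u⟩² / ‖L_β‖²` over `|β| > p`.

By the Sturm–Liouville identity `iterate_derivative_wt_pow_leg`, for each fixed `α` the functions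
`W^α D^α L_β` are again orthogonal, with squared norms `∏ (β_k + α_k)! / (β_k - α_k)! · ‖L_β‖²`.
Testing the weak derivative against `(W^α)² D^α L_β` and applying Bessel's inequality
(`sum_factQuot_mul_le`) bounds `|u|_V²` below by `∑_β a_β ∑_{|α| = s} ∏ (β_k + α_k)! / (β_k -
α_k)!`. These test polynomials vanish only on the boundary; smooth cutoffs justify the integration
by parts.

It remains to bound the inner sum below by `1 / Φ_d(|β|, s)` (`one_le_Phi_mul_sum`); since `Φ_d(·,
s)` decreases, `|β| ≥ p + 1` suffices. Write each quotient as `C(b,a) · a! (b+a)! / b!`. The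
products `∏ C(b_k, α_k)`, divided by `C(|b|, s)`, are the probabilities of a multivariate
hypergeometric law with means `s b_k / |b|`. Jensen's inequality for `exp`, for `log Γ` in `α`, and
for a convex combination of `log Γ` terms across the coordinates replaces every `b_k` by the average
`|b| / d`. A comparison of `C(|b|, s)` with Gamma values at arguments divided by `d`
(`mul_lgamma_le_log_choose`) finishes the bound.

The second inequality follows from `|W^α| ≤ 1` and `Phi_le`, with `C(s) = s!`. -/

noncomputable section
namespace CubeProj

/-! ### Inequalities for the Gamma function -/

section GammaInequalities

open Real Filter Topology

/-- `log Γ`. -/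
def lgamma (x : ℝ) : ℝ := Real.log (Real.Gamma x)

theorem convexOn_lgamma : ConvexOn ℝ (Set.Ioi 0) lgamma := Real.convexOn_log_Gamma

theorem tendsto_lgamma {x : ℝ} (hx : 0 < x) :
    Tendsto (BohrMollerup.logGammaSeq x) atTop (𝓝 (lgamma x)) :=
  BohrMollerup.tendsto_log_gamma hx

theorem lgamma_add_one {x : ℝ} (hx : 0 < x) : lgamma (x + 1) = Real.log x + lgamma x := by
  unfold lgamma
  rw [Real.Gamma_add_one hx.ne', Real.log_mul hx.ne' (Real.Gamma_pos_of_pos hx).ne']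

theorem lgamma_one : lgamma 1 = 0 := by simp [lgamma]

theorem exp_lgamma {x : ℝ} (hx : 0 < x) : Real.exp (lgamma x) = Real.Gamma x :=
  Real.exp_log (Real.Gamma_pos_of_pos hx)

theorem exp_lgamma_nat (n : ℕ) : Real.exp (lgamma (n + 1)) = (n.factorial : ℝ) := by
  rw [exp_lgamma (by positivity), Real.Gamma_nat_eq_factorial]

theorem convexOn_of_tendsto {s : Set ℝ} {F : ℕ → ℝ → ℝ} {f : ℝ → ℝ} (hs : Convex ℝ s)
    (hF : ∀ n, ConvexOn ℝ s (F n)) (h : ∀ x ∈ s, Tendsto (fun n => F n x) atTop (𝓝 (f x))) :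
    ConvexOn ℝ s f := by
  refine ⟨hs, fun x hx y hy a b ha hb hab => ?_⟩
  exact le_of_tendsto_of_tendsto' (h _ (hs hx hy ha hb hab))
    (((h x hx).const_smul a).add ((h y hy).const_smul b)) fun n => (hF n).2 hx hy ha hb hab

theorem ConvexOn.finset_sum {ι : Type*} {s : Set ℝ} (hs : Convex ℝ s) (t : Finset ι)
    {f : ι → ℝ → ℝ} (h : ∀ i ∈ t, ConvexOn ℝ s (f i)) :
    ConvexOn ℝ s (fun x => ∑ i ∈ t, f i x) := by
  classical
  induction t using Finset.induction_on with
  | empty => simpa using convexOn_const (0 : ℝ) hs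
  | insert i t hi ih =>
    simp only [Finset.sum_insert hi]
    exact (h i (Finset.mem_insert_self i t)).add (ih fun j hj => h j (Finset.mem_insert_of_mem hj))

/-- Increments of a convex function over intervals of equal length increase. -/
theorem ConvexOn.increment_mono {f : ℝ → ℝ} {s : Set ℝ} (hf : ConvexOn ℝ s f) {x y h : ℝ}
    (hx : x ∈ s) (hyh : y + h ∈ s) (hxy : x ≤ y) (hh : 0 ≤ h) :
    f (x + h) - f x ≤ f (y + h) - f y := by
  rcases eq_or_lt_of_le (add_nonneg (sub_nonneg.2 hxy) hh) with h0 | h0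
  · have h1 : h = 0 := by linarith
    simp [h1]
  -- With this `t`, `x + h` and `y` are mirror-image convex combinations of the endpoints `x` and `y
  -- + h`, so adding the two convexity inequalities gives the claim.
  set t := h / (y - x + h) with ht
  have ht0 : 0 ≤ t := by positivity
  have ht1 : 0 ≤ 1 - t := by
    rw [ht, sub_nonneg, div_le_one h0]; linarith
  have e : t * (y - x + h) = h := div_mul_cancel₀ _ h0.ne'
  have h1 := hf.2 hx hyh ht1 ht0 (by ring)
  have h2 := hf.2 hx hyh ht0 ht1 (by ring)
  simp only [smul_eq_mul] at h1 h2
  rw [show (1 - t) * x + t * (y + h) = x + h by linarith] at h1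
  rw [show t * x + (1 - t) * (y + h) = y by linarith] at h2
  linarith

/-- The derivative equals `-(l - 1) c / ((x + c) (l x + c))`, which increases with `x`. -/
theorem convexOn_log_sub_log {c l : ℝ} (hc : 0 < c) (hl : 1 ≤ l) :
    ConvexOn ℝ (Set.Ici 0) fun x => Real.log (x + c) - Real.log (l * x + c) := by
  have hpos : ∀ x ∈ Set.Ici (0 : ℝ), 0 < x + c ∧ 0 < l * x + c := fun x hx =>
    ⟨by have : (0:ℝ) ≤ x := hx; positivity, by have : (0:ℝ) ≤ x := hx; positivity⟩
  have hd : ∀ x ∈ Set.Ici (0 : ℝ), HasDerivAt (fun x => Real.log (x + c) - Real.log (l * x + c))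
      (1 / (x + c) - l / (l * x + c)) x := by
    intro x hx
    have h1 : HasDerivAt (fun x => x + c) 1 x := (hasDerivAt_id x).add_const c
    have h2 : HasDerivAt (fun x => l * x + c) l x := by
      simpa using ((hasDerivAt_id x).const_mul l).add_const c
    exact (h1.log (hpos x hx).1.ne').sub (h2.log (hpos x hx).2.ne')
  have hmono : MonotoneOn (fun x => 1 / (x + c) - l / (l * x + c)) (Set.Ici 0) := by
    intro x hx y hy hxy
    obtain ⟨a1, a2⟩ := hpos x hx
    obtain ⟨b1, b2⟩ := hpos y hy
    have hx0 : (0 : ℝ) ≤ x := hx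
    have key : ∀ z : ℝ, 0 < z + c → 0 < l * z + c →
        1 / (z + c) - l / (l * z + c) = -((l - 1) * c) * (1 / ((z + c) * (l * z + c))) := by
      intro z h1 h2
      rw [div_sub_div _ _ h1.ne' h2.ne', mul_one_div]
      congr 1
      ring
    simp only [key x a1 a2, key y b1 b2]
    refine mul_le_mul_of_nonpos_left ?_ (by nlinarith)
    exact one_div_le_one_div_of_le (by positivity) (by gcongr)
  refine MonotoneOn.convexOn_of_deriv (convex_Ici 0)
    (fun x hx => (hd x hx).continuousAt.continuousWithinAt)
    (fun x hx => (hd x (interior_subset hx)).differentiableAt.differentiableWithinAt) ?_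
  intro x hx y hy hxy
  rw [(hd x (interior_subset hx)).deriv, (hd y (interior_subset hy)).deriv]
  exact hmono (interior_subset hx) (interior_subset hy) hxy

/-- In the Euler limit for `log Γ` the difference becomes a linear function plus a sum of the convex
functions of `convexOn_log_sub_log`; convexity passes to the limit. -/
theorem convexOn_lgamma_sub_lgamma {l : ℝ} (hl : 1 ≤ l) :
    ConvexOn ℝ (Set.Ici 0) fun x => lgamma (l * x + 1) - lgamma (x + 1) := by
  refine convexOn_of_tendsto (convex_Ici 0) (F := fun n x =>
    BohrMollerup.logGammaSeq (l * x + 1) n - BohrMollerup.logGammaSeq (x + 1) n) (fun n => ?_) ?_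
  · have e : (fun x => BohrMollerup.logGammaSeq (l * x + 1) n - BohrMollerup.logGammaSeq (x + 1) n) =
        fun x => ((l - 1) * Real.log n) * x + ∑ m ∈ Finset.range (n + 1),
          (Real.log (x + (m + 1 : ℝ)) - Real.log (l * x + (m + 1 : ℝ))) := by
      ext x
      unfold BohrMollerup.logGammaSeq
      rw [Finset.sum_sub_distrib]
      simp only [add_assoc, add_comm (1 : ℝ)]
      ring
    rw [e]
    refine ConvexOn.add ?_ (ConvexOn.finset_sum (convex_Ici 0) _ fun m _ =>
      convexOn_log_sub_log (by positivity) hl)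
    exact (LinearMap.mulLeft ℝ ((l - 1) * Real.log n)).convexOn (convex_Ici 0)
  · intro x hx
    have hx0 : (0 : ℝ) ≤ x := hx
    exact (tendsto_lgamma (by positivity)).sub (tendsto_lgamma (by positivity))

/-- This is the Jensen gap of `log` at `z + 1 - δ`, between `z` and `z + 1`. Its derivative is `-δ
(1 - δ) / (z (z + 1) (z + 1 - δ))`. -/
theorem antitoneOn_log_combination {δ : ℝ} (h0 : 0 ≤ δ) (h1 : δ ≤ 1) :
    AntitoneOn (fun z => Real.log (z + 1 - δ) - (1 - δ) * Real.log (z + 1) - δ * Real.log z)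
      (Set.Ioi 0) := by
  have hd : ∀ z ∈ Set.Ioi (0 : ℝ), HasDerivAt
      (fun z => Real.log (z + 1 - δ) - (1 - δ) * Real.log (z + 1) - δ * Real.log z)
      (1 / (z + 1 - δ) - (1 - δ) * (1 / (z + 1)) - δ * (1 / z)) z := by
    intro z hz
    have hz0 : (0 : ℝ) < z := hz
    have a1 : HasDerivAt (fun z : ℝ => z + 1 - δ) 1 z :=
      ((hasDerivAt_id z).add_const 1).sub_const δ
    have a2 : HasDerivAt (fun z : ℝ => z + 1) 1 z := (hasDerivAt_id z).add_const 1
    exact ((a1.log (by linarith)).sub ((a2.log (by positivity)).const_mul _)).sub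
      (((hasDerivAt_id z).log hz0.ne').const_mul _)
  refine antitoneOn_of_deriv_nonpos (convex_Ioi 0)
    (fun x hx => (hd x hx).continuousAt.continuousWithinAt)
    (fun x hx => (hd x (interior_subset hx)).differentiableAt.differentiableWithinAt) ?_
  intro z hz
  have hz0 : (0 : ℝ) < z := interior_subset hz
  rw [(hd z hz0).deriv]
  have e : 1 / (z + 1 - δ) - (1 - δ) * (1 / (z + 1)) - δ * (1 / z) =
      -(δ * (1 - δ)) / (z * (z + 1) * (z + 1 - δ)) := by
    have : z + 1 - δ ≠ 0 := by linarith
    field_simp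
    ring
  rw [e]
  exact div_nonpos_of_nonpos_of_nonneg (by nlinarith)
    (mul_nonneg (by positivity) (by linarith))

/-- Since `log y = lgamma (y + 1) - lgamma y`, this is the Jensen gap of `lgamma` between `y` and `y
+ 1`. In the Euler limit the affine terms cancel and a sum of Jensen gaps of `log` remains. -/
theorem antitoneOn_lgamma_combination {δ : ℝ} (h0 : 0 ≤ δ) (h1 : δ ≤ 1) :
    AntitoneOn (fun y => lgamma (y + 1) - lgamma (y + 1 - δ) - δ * Real.log y) (Set.Ioi 0) := by
  intro x hx y hy hxy
  have lim : ∀ z : ℝ, 0 < z → Tendsto (fun n => BohrMollerup.logGammaSeq (z + 1) n -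
      BohrMollerup.logGammaSeq (z + 1 - δ) n -
      δ * (BohrMollerup.logGammaSeq (z + 1) n - BohrMollerup.logGammaSeq z n)) atTop
      (𝓝 (lgamma (z + 1) - lgamma (z + 1 - δ) - δ * Real.log z)) := by
    intro z hz
    have e : Real.log z = lgamma (z + 1) - lgamma z := by rw [lgamma_add_one hz]; ring
    rw [e]
    have a1 := tendsto_lgamma (show 0 < z + 1 by positivity)
    have a2 := tendsto_lgamma (show 0 < z + 1 - δ by linarith)
    exact (a1.sub a2).sub ((a1.sub (tendsto_lgamma hz)).const_mul δ)
  refine le_of_tendsto_of_tendsto' (lim y hy) (lim x hx) fun n => ?_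
  have e : ∀ z : ℝ, BohrMollerup.logGammaSeq (z + 1) n - BohrMollerup.logGammaSeq (z + 1 - δ) n -
      δ * (BohrMollerup.logGammaSeq (z + 1) n - BohrMollerup.logGammaSeq z n) =
      ∑ m ∈ Finset.range (n + 1), (Real.log (z + m + 1 - δ) - (1 - δ) * Real.log (z + m + 1)
        - δ * Real.log (z + m)) := by
    intro z
    unfold BohrMollerup.logGammaSeq
    simp only [Finset.sum_sub_distrib, ← Finset.mul_sum]
    simp only [show ∀ m : ℕ, z + 1 + (m : ℝ) = z + m + 1 from fun m => by ring,
      show ∀ m : ℕ, z + 1 - δ + (m : ℝ) = z + m + 1 - δ from fun m => by ring]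
    ring
  rw [e x, e y]
  refine Finset.sum_le_sum fun m _ => ?_
  have hx0 : (0 : ℝ) < x := hx
  have hy0 : (0 : ℝ) < y := hy
  exact antitoneOn_log_combination h0 h1 (show (0 : ℝ) < x + m by positivity)
    (show (0 : ℝ) < y + m by positivity) (by linarith)

/-- Induction on `s`: the right side grows by `log ((n + s + 1) / (s + 1))`, and
`antitoneOn_lgamma_combination` with `δ = 1 / d`, taken between `(s + 1) / d` and `(n + s + 1) / d`,
says that the left side grows by no more. -/
theorem mul_lgamma_le_log_choose {d : ℕ} (hd : 1 ≤ d) (n s : ℕ) :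
    d * (lgamma ((n + s : ℝ) / d + 1) - lgamma ((s : ℝ) / d + 1) - lgamma ((n : ℝ) / d + 1)) ≤
      Real.log ((n + s).choose s) := by
  have hd0 : (0 : ℝ) < d := by exact_mod_cast hd
  induction s with
  | zero => simp [lgamma_one]
  | succ s ih =>
    have hch : (((n + (s + 1)).choose (s + 1) : ℕ) : ℝ) =
        ((n + s).choose s : ℝ) * ((n + s + 1) / (s + 1)) := by
      have := Nat.add_one_mul_choose_eq (n + s) s
      have h' : ((n + s + 1 : ℝ)) * ((n + s).choose s) = ((n + s + 1).choose (s + 1)) * (s + 1) := by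
        exact_mod_cast this
      rw [← add_assoc]
      field_simp
      linarith
    have hcp : (0 : ℝ) < ((n + s).choose s : ℝ) := by
      exact_mod_cast Nat.choose_pos (Nat.le_add_left s n)
    rw [hch, Real.log_mul hcp.ne' (by positivity), Real.log_div (by positivity) (by positivity)]
    have h := antitoneOn_lgamma_combination (δ := 1 / d) (by positivity)
      (by rw [div_le_one hd0]; exact_mod_cast hd)
      (show (0 : ℝ) < (s + 1 : ℝ) / d by positivity)
      (show (0 : ℝ) < (n + s + 1 : ℝ) / d by positivity)
      (by gcongr; linarith [(Nat.cast_nonneg n : (0 : ℝ) ≤ n)])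
    simp only at h
    rw [Real.log_div (by positivity) hd0.ne', Real.log_div (by positivity) hd0.ne'] at h
    rw [show (n + s + 1 : ℝ) / d + 1 - 1 / d = (n + s : ℝ) / d + 1 by ring,
      show (s + 1 : ℝ) / d + 1 - 1 / d = (s : ℝ) / d + 1 by ring] at h
    have h2 := mul_le_mul_of_nonneg_left h hd0.le
    have h3 : ∀ A B L M : ℝ, (d : ℝ) * (A - B - 1 / d * (L - M)) = d * (A - B) - (L - M) := by
      intro A B L M; field_simp
    rw [h3, h3] at h2
    push_cast
    rw [← add_assoc]
    linarith

theorem Phi_eq_exp {d : ℕ} {m n : ℝ} (h1 : 0 < (m - n) / d + 1) (h2 : 0 < (m + n) / d + 1) :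
    Phi d m n = Real.exp (-(d * (lgamma ((m + n) / d + 1) - lgamma ((m - n) / d + 1)))) := by
  unfold Phi
  rw [← exp_lgamma h1, ← exp_lgamma h2, ← Real.exp_sub, ← Real.exp_nat_mul]
  congr 1
  ring

theorem Phi_nonneg {d : ℕ} {m n : ℕ} (h : n ≤ m) : 0 ≤ Phi d m n := by
  have h' : (n : ℝ) ≤ m := by exact_mod_cast h
  rw [Phi_eq_exp (by have := sub_nonneg.2 h'; positivity) (by positivity)]
  positivity

/-- `-log Φ / d` is an increment of the convex function `log Γ` over an interval of fixed length `2
s / d`, which moves right as `m` grows. -/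
theorem Phi_antitone {d : ℕ} {m m' s : ℕ} (hs : s ≤ m) (hm : m ≤ m') :
    Phi d m' s ≤ Phi d m s := by
  have h1 : (s : ℝ) ≤ m := by exact_mod_cast hs
  have h2 : (m : ℝ) ≤ m' := by exact_mod_cast hm
  have p1 : (0 : ℝ) < (m - s) / d + 1 := by have := sub_nonneg.2 h1; positivity
  have p2 : (0 : ℝ) < (m' - s) / d + 1 := by have := sub_nonneg.2 (h1.trans h2); positivity
  rw [Phi_eq_exp p1 (by positivity), Phi_eq_exp p2 (by positivity)]
  refine Real.exp_le_exp.2 (neg_le_neg (mul_le_mul_of_nonneg_left ?_ (by positivity)))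
  have := ConvexOn.increment_mono convexOn_lgamma (x := (m - s) / d + 1)
    (y := (m' - s) / d + 1) (h := 2 * s / d) p1
    (show (0 : ℝ) < (m' - s) / d + 1 + 2 * s / d by positivity) (by gcongr) (by positivity)
  rwa [show (m - s : ℝ) / d + 1 + 2 * s / d = (m + s) / d + 1 by ring,
    show (m' - s : ℝ) / d + 1 + 2 * s / d = (m' + s) / d + 1 by ring] at this

/-- With `y = (x + 1) / d`, the point `x / d + 1 = y + 1 - 1 / d` lies between `y` and `y + 1`;
convexity and the functional equation give the bound. -/
theorem log_le_mul_lgamma_increment {d : ℕ} (hd : 1 ≤ d) {x : ℝ} (hx : 0 ≤ x) :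
    Real.log ((x + 1) / d) ≤ d * (lgamma ((x + 1) / d + 1) - lgamma (x / d + 1)) := by
  have hd0 : (0 : ℝ) < d := by exact_mod_cast hd
  have hd1 : (1 : ℝ) ≤ d := by exact_mod_cast hd
  set y := (x + 1) / d with hy
  have hy0 : 0 < y := by positivity
  have hx' : x / d + 1 = y + 1 - 1 / d := by rw [hy]; ring
  rw [hx']
  have hδ : 1 / (d : ℝ) ≤ 1 := by rw [div_le_one hd0]; exact hd1
  have h := convexOn_lgamma.2 (x := y) (y := y + 1) hy0 (show (0 : ℝ) < y + 1 by positivity)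
    (show 0 ≤ 1 / (d : ℝ) by positivity) (sub_nonneg.2 hδ) (by ring)
  simp only [smul_eq_mul] at h
  rw [show 1 / (d : ℝ) * y + (1 - 1 / d) * (y + 1) = y + 1 - 1 / d by ring,
    lgamma_add_one hy0] at h
  rw [lgamma_add_one hy0]
  have h2 := mul_le_mul_of_nonneg_left h hd0.le
  have h3 : (d : ℝ) * (1 / d * lgamma y + (1 - 1 / d) * (Real.log y + lgamma y)) =
      d * (Real.log y + lgamma y) - Real.log y := by field_simp; ring
  linarith

theorem Phi_le {d : ℕ} (hd : 1 ≤ d) {m s : ℕ} (hs : s ≤ m) :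
    Phi d m s ≤ s.factorial * ((d : ℝ) / m) ^ (2 * s) := by
  have hd0 : (0 : ℝ) < d := by exact_mod_cast hd
  induction s with
  | zero =>
    have : Real.Gamma ((m : ℝ) / d + 1) ≠ 0 := (Real.Gamma_pos_of_pos (by positivity)).ne'
    simp [Phi, this]
  | succ s ih =>
    have ih := ih (by omega)
    have hsm : (s : ℝ) + 1 ≤ m := by exact_mod_cast hs
    have hm0 : (0 : ℝ) < m := by linarith [(Nat.cast_nonneg s : (0 : ℝ) ≤ s)]
    -- Raising `s` by one moves both arguments of `Φ` outwards by `1 / d`; `a1` and `a2` bound the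
    -- two increments of `log Γ`.
    have a1 := log_le_mul_lgamma_increment hd (x := m + s) (by positivity)
    have a2 := log_le_mul_lgamma_increment hd (x := m - s - 1) (by linarith)
    have pos : (0 : ℝ) < m - s := by linarith
    have p1 : (0 : ℝ) < (m - s) / d + 1 := by positivity
    have p2 : (0 : ℝ) < (m - s - 1) / d + 1 := by
      have : (0 : ℝ) ≤ m - s - 1 := by linarith
      positivity
    rw [show (m : ℝ) - s - 1 + 1 = m - s by ring] at a2
    have step : Phi d m (s + 1 : ℕ) ≤
        Phi d m s * ((((m + s + 1 : ℝ)) / d) * ((m - s : ℝ) / d))⁻¹ := by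
      rw [Phi_eq_exp p1 (by positivity), Phi_eq_exp (by push_cast; rwa [← sub_sub])
        (by positivity)]
      rw [← Real.exp_log (show 0 < (((m + s + 1 : ℝ)) / d) * ((m - s : ℝ) / d) by positivity),
        ← Real.exp_neg, ← Real.exp_add, Real.log_mul (by positivity) (by positivity)]
      refine Real.exp_le_exp.2 ?_
      push_cast
      rw [← sub_sub, ← add_assoc]
      linarith
    have hprod : ((((m + s + 1 : ℝ)) / d) * ((m - s : ℝ) / d))⁻¹ ≤ (s + 1) * ((d : ℝ) / m) ^ 2 := by
      rw [div_pow, div_mul_div_comm, inv_div, ← mul_div_assoc,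
        div_le_div_iff₀ (by positivity) (by positivity)]
      -- The difference of the two sides is `s (m - s - 1)`. This factor `s + 1` accumulates to
      -- `s!`.
      have h1 : (m : ℝ) ≤ (s + 1) * (m - s) := by
        nlinarith [(Nat.cast_nonneg s : (0 : ℝ) ≤ s)]
      have h2 : (m : ℝ) ≤ m + s + 1 := by linarith [(Nat.cast_nonneg s : (0 : ℝ) ≤ s)]
      have h3 : (m : ℝ) * m ≤ (m + s + 1) * ((s + 1) * (m - s)) := by gcongr
      nlinarith [mul_le_mul_of_nonneg_left h3 (sq_nonneg (d : ℝ))]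
    calc Phi d m (s + 1 : ℕ) ≤ _ := step
      _ ≤ (s.factorial * ((d : ℝ) / m) ^ (2 * s)) * ((s + 1) * ((d : ℝ) / m) ^ 2) := by
        gcongr
      _ = _ := by rw [Nat.factorial_succ]; push_cast; ring

end GammaInequalities

/-! ### A lower bound for sums of factorial quotients -/

section FactorialQuotients

/-- The quotient `(b + a)! / (b - a)!`, which is `0` if `b < a`. -/
def factQuot (b a : ℕ) : ℕ := (b + a).descFactorial (2 * a)

theorem factQuot_eq_zero {b a : ℕ} (h : b < a) : factQuot b a = 0 := by
  unfold factQuot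
  exact Nat.descFactorial_eq_zero_iff_lt.2 (by omega)

theorem factQuot_zero (b : ℕ) : factQuot b 0 = 1 := by simp [factQuot]

theorem factQuot_mul {b a : ℕ} (h : a ≤ b) :
    factQuot b a * (b - a).factorial = (b + a).factorial := by
  have := Nat.factorial_mul_descFactorial (show 2 * a ≤ b + a by omega)
  rw [show b + a - 2 * a = b - a by omega] at this
  rw [factQuot, mul_comm, this]

theorem factQuot_succ {b a : ℕ} (h : a ≤ b) :
    factQuot b (a + 1) = factQuot b a * ((b - a) * (b + a + 1)) := by
  rcases eq_or_lt_of_le h with rfl | h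
  · simp [factQuot_eq_zero]
  · have h1 := factQuot_mul (show a + 1 ≤ b from h)
    have h2 := factQuot_mul h.le
    have e : (b - a).factorial = (b - a) * (b - (a + 1)).factorial := by
      obtain ⟨k, hk⟩ : ∃ k, b - a = k + 1 := ⟨b - a - 1, by omega⟩
      rw [hk, show b - (a + 1) = k by omega, Nat.factorial_succ]
    rw [← add_assoc, Nat.factorial_succ, ← h2, e] at h1
    refine Nat.eq_of_mul_eq_mul_right (Nat.factorial_pos (b - (a + 1))) ?_
    rw [h1]; ring

/-- The binomial factor takes care of the zeros for `b < a`, so what is left has a logarithm and is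
open to Jensen's inequality. -/
theorem factQuot_eq_choose (b a : ℕ) :
    (factQuot b a : ℝ) = b.choose a *
      Real.exp (lgamma (a + 1) + lgamma ((b + a : ℕ) + 1) - lgamma (b + 1)) := by
  rw [Real.exp_sub, Real.exp_add, exp_lgamma_nat, exp_lgamma_nat, exp_lgamma_nat]
  rcases le_or_gt a b with h | h
  · have h1 := factQuot_mul h
    have h2 := Nat.choose_mul_factorial_mul_factorial h
    have h3 : (0 : ℝ) < (b - a).factorial := by exact_mod_cast Nat.factorial_pos _
    have h4 : (0 : ℝ) < b.factorial := by exact_mod_cast Nat.factorial_pos _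
    rw [mul_div_assoc', eq_div_iff h4.ne', ← h1, ← h2]
    push_cast
    ring
  · simp [factQuot_eq_zero h, Nat.choose_eq_zero_of_lt h]

theorem coeff_prod_piAntidiag {ι : Type*} [Fintype ι] [DecidableEq ι] (f : ι → Polynomial ℝ)
    (s : ℕ) : (∏ i, f i).coeff s =
      ∑ α ∈ (Finset.univ : Finset ι).piAntidiag s, ∏ i, (f i).coeff (α i) := by
  have h := PowerSeries.coeff_prod (fun i => (f i : PowerSeries ℝ)) s Finset.univ
  have e : ((∏ i, f i : Polynomial ℝ) : PowerSeries ℝ) = ∏ i, (f i : PowerSeries ℝ) :=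
    map_prod (Polynomial.coeToPowerSeries.ringHom (R := ℝ)) _ _
  rw [← e, Polynomial.coeff_coe] at h
  rw [h]
  refine Finset.sum_bij' (fun l _ => ⇑l) (fun l _ => Finsupp.equivFunOnFinite.symm l) ?_ ?_ ?_ ?_ ?_
  all_goals simp [Finset.mem_finsuppAntidiag, Finset.mem_piAntidiag]

theorem sum_prod_choose {ι : Type*} [Fintype ι] [DecidableEq ι] (b : ι → ℕ) (s : ℕ) :
    ∑ α ∈ (Finset.univ : Finset ι).piAntidiag s, ∏ i, ((b i).choose (α i) : ℝ) =
      (∑ i, b i).choose s := by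
  have h := coeff_prod_piAntidiag (fun i => (1 + Polynomial.X : Polynomial ℝ) ^ b i) s
  simp only [Polynomial.coeff_one_add_X_pow, Finset.prod_pow_eq_pow_sum] at h
  exact h.symm

/-- The mean of the multivariate hypergeometric law, cleared of denominators. The extra factor `α k`
comes from applying `X d/dX` to the `k`-th factor of `∏ (1 + X)^{b_i}`. -/
theorem sum_prod_choose_mul {ι : Type*} [Fintype ι] [DecidableEq ι] (b : ι → ℕ) (s : ℕ) (k : ι) :
    (∑ i, b i : ℕ) * ∑ α ∈ (Finset.univ : Finset ι).piAntidiag s,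
      (∏ i, ((b i).choose (α i) : ℝ)) * α k = (∑ i, b i).choose s * (s * b k) := by
  have hX : ∀ n j : ℕ, (Polynomial.X * Polynomial.derivative
      ((1 + Polynomial.X : Polynomial ℝ) ^ n)).coeff j = (n.choose j : ℝ) * j := by
    intro n j
    cases j with
    | zero => simp
    | succ j =>
      rw [Polynomial.coeff_X_mul, Polynomial.coeff_derivative, Polynomial.coeff_one_add_X_pow]
      push_cast; rfl
  have hder : ∀ n : ℕ, Polynomial.derivative ((1 + Polynomial.X : Polynomial ℝ) ^ n) *
      (1 + Polynomial.X) = (n : Polynomial ℝ) * (1 + Polynomial.X) ^ n := by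
    intro n
    cases n with
    | zero => simp
    | succ n =>
      rw [Polynomial.derivative_pow]
      simp [pow_succ]
      ring
  have hs : ∑ α ∈ (Finset.univ : Finset ι).piAntidiag s, (∏ i, ((b i).choose (α i) : ℝ)) * α k =
      (Polynomial.X * Polynomial.derivative ((1 + Polynomial.X : Polynomial ℝ) ^ b k) *
        ∏ i ∈ Finset.univ.erase k, (1 + Polynomial.X : Polynomial ℝ) ^ b i).coeff s := by
    have h := coeff_prod_piAntidiag (Function.update
      (fun i => (1 + Polynomial.X : Polynomial ℝ) ^ b i) k
      (Polynomial.X * Polynomial.derivative ((1 + Polynomial.X : Polynomial ℝ) ^ b k))) s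
    rw [← Finset.mul_prod_erase _ _ (Finset.mem_univ k), Function.update_self] at h
    rw [Finset.prod_congr rfl fun i hi => Function.update_of_ne (Finset.ne_of_mem_erase hi) _ _] at h
    rw [h]
    refine Finset.sum_congr rfl fun α _ => ?_
    rw [← Finset.mul_prod_erase _ _ (Finset.mem_univ k),
      ← Finset.mul_prod_erase (a := k) _ _ (Finset.mem_univ k), Function.update_self, hX]
    have : ∀ i ∈ Finset.univ.erase k, (Function.update
        (fun i => (1 + Polynomial.X : Polynomial ℝ) ^ b i) k
        (Polynomial.X * Polynomial.derivative ((1 + Polynomial.X : Polynomial ℝ) ^ b k)) i).coeff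
        (α i) = ((b i).choose (α i) : ℝ) := fun i hi => by
      rw [Function.update_of_ne (Finset.ne_of_mem_erase hi), Polynomial.coeff_one_add_X_pow]
    rw [Finset.prod_congr rfl this]
    ring
  rw [hs]
  -- Both sides are `|b| b_k X (1 + X)^{|b| - 1}`; cancelling a factor `1 + X` avoids the exponent
  -- `|b| - 1`.
  have key : ((∑ i, b i : ℕ) : Polynomial ℝ) *
      (Polynomial.X * Polynomial.derivative ((1 + Polynomial.X : Polynomial ℝ) ^ b k) *
        ∏ i ∈ Finset.univ.erase k, (1 + Polynomial.X : Polynomial ℝ) ^ b i) =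
      (b k : Polynomial ℝ) * (Polynomial.X *
        Polynomial.derivative ((1 + Polynomial.X : Polynomial ℝ) ^ (∑ i, b i))) := by
    have hne : (1 + Polynomial.X : Polynomial ℝ) ≠ 0 := by
      rw [add_comm]; exact Polynomial.X_add_C_ne_zero 1
    refine mul_right_cancel₀ hne ?_
    have e1 : (1 + Polynomial.X : Polynomial ℝ) ^ (∑ i, b i) = (1 + Polynomial.X) ^ b k *
        ∏ i ∈ Finset.univ.erase k, (1 + Polynomial.X : Polynomial ℝ) ^ b i := by
      rw [Finset.mul_prod_erase _ (fun i => (1 + Polynomial.X : Polynomial ℝ) ^ b i)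
        (Finset.mem_univ k), Finset.prod_pow_eq_pow_sum]
    have h1 := hder (b k)
    have h2 := hder (∑ i, b i)
    calc _ = ((∑ i, b i : ℕ) : Polynomial ℝ) * Polynomial.X *
          (Polynomial.derivative ((1 + Polynomial.X : Polynomial ℝ) ^ b k) * (1 + Polynomial.X)) *
          ∏ i ∈ Finset.univ.erase k, (1 + Polynomial.X : Polynomial ℝ) ^ b i := by ring
      _ = (b k : Polynomial ℝ) * (Polynomial.X *
          (((∑ i, b i : ℕ) : Polynomial ℝ) * (1 + Polynomial.X) ^ (∑ i, b i))) := by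
        rw [h1, e1]; ring
      _ = _ := by rw [← h2]; ring
  have hc := congrArg (fun q => Polynomial.coeff q s) key
  simp only [Polynomial.coeff_natCast_mul, hX] at hc
  rw [hc]
  ring

theorem convexOn_lgamma_add_one : ConvexOn ℝ (Set.Ici 0) fun x : ℝ => lgamma (x + 1) := by
  have := convexOn_lgamma.translate_left (c := 1)
  refine ConvexOn.subset (t := (fun z : ℝ => z + 1) ⁻¹' Set.Ioi 0) ?_ ?_ (convex_Ici 0)
  · simpa [Function.comp_def] using this
  · intro x hx
    have : (0 : ℝ) ≤ x := hx
    show (0 : ℝ) < x + 1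
    positivity

/-- The sum over all multi-indices `α` with `|α| = s` of `∏ (b_k + α_k)! / (b_k - α_k)!` is at
least `1 / Φ_d(|b|, s)`. -/
theorem one_le_Phi_mul_sum {d : ℕ} (hd : 1 ≤ d) (b : Fin d → ℕ) (s : ℕ) (hm : 0 < ∑ i, b i)
    (hs : s ≤ ∑ i, b i) :
    1 ≤ Phi d (∑ i, b i : ℕ) s * ∑ α ∈ (Finset.univ : Finset (Fin d)).piAntidiag s,
      ∏ i, (factQuot (b i) (α i) : ℝ) := by
  set m := ∑ i, b i with hmdef
  set A := (Finset.univ : Finset (Fin d)).piAntidiag s with hA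
  have hd0 : (0 : ℝ) < d := by exact_mod_cast hd
  have hm0 : (0 : ℝ) < m := by exact_mod_cast hm
  have hsm : (s : ℝ) ≤ m := by exact_mod_cast hs
  have hC : (0 : ℝ) < m.choose s := by exact_mod_cast Nat.choose_pos hs
  set θ : ℝ := s / m with hθ
  have hθ0 : 0 ≤ θ := by positivity
  -- Hypergeometric weights: total mass one by Vandermonde, and mean of `α k` equal to `θ * b k`.
  set w : (Fin d → ℕ) → ℝ := fun α => (∏ i, ((b i).choose (α i) : ℝ)) / m.choose s with hw
  have hw0 : ∀ α ∈ A, 0 ≤ w α := fun α _ => by positivity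
  have hw1 : ∑ α ∈ A, w α = 1 := by
    rw [hw, ← Finset.sum_div, hA, sum_prod_choose, ← hmdef, div_self hC.ne']
  have hwmean : ∀ k, ∑ α ∈ A, w α * α k = θ * b k := by
    intro k
    have h := sum_prod_choose_mul b s k
    rw [← hmdef, ← hA] at h
    simp only [hw, div_mul_eq_mul_div]
    rw [← Finset.sum_div, div_eq_iff hC.ne', hθ, div_mul_eq_mul_div, div_mul_eq_mul_div,
      eq_div_iff hm0.ne']
    linarith
  set z : (Fin d → ℕ) → ℝ := fun α => ∑ k, (lgamma (α k + 1) + lgamma ((b k + α k : ℕ) + 1)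
    - lgamma (b k + 1)) with hz
  have hS : ∑ α ∈ A, ∏ i, (factQuot (b i) (α i) : ℝ) =
      m.choose s * ∑ α ∈ A, w α * Real.exp (z α) := by
    rw [Finset.mul_sum]
    refine Finset.sum_congr rfl fun α _ => ?_
    simp only [factQuot_eq_choose, Finset.prod_mul_distrib, hw, hz, Real.exp_sum]
    field_simp
  have hJ : Real.exp (∑ α ∈ A, w α * z α) ≤ ∑ α ∈ A, w α * Real.exp (z α) := by
    have := convexOn_exp.map_sum_le hw0 hw1 (p := z) (fun _ _ => Set.mem_univ _)
    simpa using this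
  -- The `k`-th summand of `z` at the mean of `α`, as a function of `b k`. The concave term `-lgamma
  -- (x + 1)` is absorbed by the one with slope `1 + θ ≥ 1`.
  set g : ℝ → ℝ := fun x => lgamma (θ * x + 1) + (lgamma ((1 + θ) * x + 1) - lgamma (x + 1)) with hg
  have hgc : ConvexOn ℝ (Set.Ici 0) g := by
    refine ConvexOn.add ?_ (convexOn_lgamma_sub_lgamma (by linarith))
    refine ⟨convex_Ici 0, fun x hx y hy a c ha hc hac => ?_⟩
    have := convexOn_lgamma_add_one.2 (mul_nonneg hθ0 hx) (mul_nonneg hθ0 hy) ha hc hac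
    simp only [smul_eq_mul] at this ⊢
    rwa [show θ * (a * x + c * y) = a * (θ * x) + c * (θ * y) by ring]
  have hz1 : ∑ k, g (b k) ≤ ∑ α ∈ A, w α * z α := by
    simp only [hz, Finset.mul_sum]
    rw [Finset.sum_comm]
    refine Finset.sum_le_sum fun k _ => ?_
    have e1 := convexOn_lgamma_add_one.map_sum_le hw0 hw1 (p := fun α => (α k : ℝ))
      (fun α _ => Set.mem_Ici.2 (Nat.cast_nonneg _))
    have e2 := convexOn_lgamma_add_one.map_sum_le hw0 hw1 (p := fun α => (b k + α k : ℝ))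
      (fun α _ => show (0 : ℝ) ≤ _ by positivity)
    simp only [smul_eq_mul, mul_add, Finset.sum_add_distrib, ← Finset.sum_mul, hw1, hwmean] at e1 e2
    simp only [mul_sub, mul_add, Finset.sum_sub_distrib, Finset.sum_add_distrib, ← Finset.sum_mul,
      hw1, hg, Nat.cast_add]
    rw [show (1 + θ) * (b k : ℝ) = 1 * b k + θ * b k by ring]
    linarith
  -- Jensen across the coordinates with equal weights `1 / d`.
  have hz2 : d * g (m / d) ≤ ∑ k, g (b k) := by
    have h := hgc.map_sum_le (t := (Finset.univ : Finset (Fin d))) (w := fun _ => 1 / (d : ℝ))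
      (p := fun k => (b k : ℝ)) (fun _ _ => by positivity) (by simp; field_simp)
      (fun _ _ => Set.mem_Ici.2 (Nat.cast_nonneg _))
    simp only [smul_eq_mul, ← Finset.mul_sum] at h
    rw [show ∑ k, (b k : ℝ) = m by rw [hmdef]; push_cast; rfl] at h
    have h2 := mul_le_mul_of_nonneg_left h hd0.le
    rw [← mul_assoc, mul_one_div_cancel hd0.ne', one_mul, one_div_mul_eq_div] at h2
    exact h2
  -- The bound on `log C(m, s)` cancels the terms at `s / d + 1` and `m / d + 1` in `g (m / d)`,
  -- leaving exactly `-log Φ`.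
  have hch := mul_lgamma_le_log_choose hd (m - s) s
  rw [Nat.cast_sub hs, Nat.sub_add_cancel hs, sub_add_cancel] at hch
  have hg' : g (m / d) = lgamma ((s : ℝ) / d + 1) +
      (lgamma ((m + s : ℝ) / d + 1) - lgamma ((m : ℝ) / d + 1)) := by
    simp only [hg, hθ]
    congr 2
    · congr 1; field_simp
    · congr 2; field_simp
  have p1 : (0 : ℝ) < (m - s) / d + 1 := by have := sub_nonneg.2 hsm; positivity
  rw [Phi_eq_exp p1 (by positivity), hS]
  calc (1 : ℝ) = Real.exp 0 := Real.exp_zero.symm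
    _ ≤ Real.exp (-(d * (lgamma ((m + s : ℝ) / d + 1) - lgamma ((m - s : ℝ) / d + 1))) +
        (Real.log (m.choose s) + ∑ α ∈ A, w α * z α)) := by
      refine Real.exp_le_exp.2 ?_
      have := hz2.trans hz1
      rw [hg'] at this
      linarith
    _ = Real.exp (-(d * (lgamma ((m + s : ℝ) / d + 1) - lgamma ((m - s : ℝ) / d + 1)))) *
        (m.choose s * Real.exp (∑ α ∈ A, w α * z α)) := by
      rw [Real.exp_add, Real.exp_add, Real.exp_log hC]
    _ ≤ _ := by gcongr

end FactorialQuotients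


/-! ### Legendre polynomials on `(-1,1)` -/

section Legendre

open Polynomial

/-- The Legendre polynomial of degree `b`, up to a constant factor (Rodrigues' formula). -/
def leg (b : ℕ) : ℝ[X] := derivative^[b] ((X ^ 2 - 1) ^ b)

/-- The polynomial `1 - X²`. -/
def wt : ℝ[X] := 1 - X ^ 2

theorem derivative_wt : derivative wt = -(2 * X) := by
  simp [wt]
  norm_num

theorem iterate_derivative_ode (b j : ℕ) :
    (X ^ 2 - 1) * derivative^[j + 2] ((X ^ 2 - 1 : ℝ[X]) ^ b) +
        2 * ((j : ℝ[X]) + 1) * X * derivative^[j + 1] ((X ^ 2 - 1 : ℝ[X]) ^ b) +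
        (j : ℝ[X]) * ((j : ℝ[X]) + 1) * derivative^[j] ((X ^ 2 - 1 : ℝ[X]) ^ b) =
      2 * (b : ℝ[X]) * X * derivative^[j + 1] ((X ^ 2 - 1 : ℝ[X]) ^ b) +
        2 * (b : ℝ[X]) * ((j : ℝ[X]) + 1) * derivative^[j] ((X ^ 2 - 1 : ℝ[X]) ^ b) := by
  set z : ℝ[X] := (X ^ 2 - 1) ^ b with hz
  -- This first-order equation is all that is used about `z`; differentiating it `j + 1` times gives
  -- the claim.
  have base : (X ^ 2 - 1) * derivative z = 2 * (b : ℝ[X]) * X * z := by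
    rw [hz]
    cases b with
    | zero => simp
    | succ b =>
      rw [derivative_pow]
      simp [pow_succ]
      ring
  have hC : (C (2 : ℝ) : ℝ[X]) = 2 := rfl
  clear_value z
  induction j with
  | zero =>
    have h := congrArg derivative base
    simp only [derivative_mul, derivative_sub, derivative_X_pow, derivative_one, derivative_X,
      derivative_natCast, derivative_ofNat] at h
    simp only [Function.iterate_succ_apply', Function.iterate_zero_apply, zero_add]
    norm_num [hC] at h ⊢
    linear_combination h
  | succ j ih =>
    have h := congrArg derivative ih
    simp only [derivative_add, derivative_mul, derivative_sub, derivative_X_pow, derivative_one,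
      derivative_X, derivative_natCast, derivative_ofNat, ← Function.iterate_succ_apply'] at h
    norm_num [hC] at h ⊢
    linear_combination h

theorem leg_ode (b a : ℕ) :
    wt * derivative^[a + 2] (leg b) - 2 * ((a : ℝ[X]) + 1) * X * derivative^[a + 1] (leg b) =
      -(((b : ℝ[X]) - (a : ℝ[X])) * ((b : ℝ[X]) + (a : ℝ[X]) + 1)) * derivative^[a] (leg b) := by
  have h := iterate_derivative_ode b (a + b)
  have e : ∀ k, derivative^[k] (leg b) = derivative^[k + b] ((X ^ 2 - 1 : ℝ[X]) ^ b) := fun k => by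
    rw [leg, Function.iterate_add_apply]
  rw [e, e, e, show a + 2 + b = a + b + 2 by ring, show a + 1 + b = a + b + 1 by ring, wt]
  push_cast at h
  linear_combination -h

theorem derivative_wt_pow_mul (e : ℕ) (f : ℝ[X]) :
    derivative (wt ^ (e + 1) * f) = wt ^ e * (wt * derivative f - 2 * ((e : ℝ[X]) + 1) * X * f) := by
  rw [derivative_mul, derivative_pow, derivative_wt]
  simp
  ring

/-- The Sturm–Liouville identity for the derivatives of Legendre polynomials. -/
theorem iterate_derivative_wt_pow_leg (b a : ℕ) :
    derivative^[a] (wt ^ a * derivative^[a] (leg b)) =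
      C ((-1) ^ a * (factQuot b a : ℝ)) * leg b := by
  induction a with
  | zero => simp [factQuot_zero]
  | succ a ih =>
    have hq : (factQuot b (a + 1) : ℝ) = factQuot b a * ((b - a) * (b + a + 1)) := by
      rcases le_or_gt a b with h | h
      · rw [factQuot_succ h]; push_cast [Nat.cast_sub h]; ring
      · rw [factQuot_eq_zero h, factQuot_eq_zero (by omega)]; simp
    -- The Legendre equation differentiated `a` times, in divergence form: each step contributes the
    -- eigenvalue `-(b - a)(b + a + 1)`.
    have e : derivative (wt ^ (a + 1) * derivative^[a + 1] (leg b)) =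
        C (-((b - a : ℝ) * (b + a + 1))) * (wt ^ a * derivative^[a] (leg b)) := by
      rw [derivative_wt_pow_mul, ← Function.iterate_succ_apply' derivative, leg_ode]
      simp
      ring
    rw [Function.iterate_succ_apply, e, iterate_derivative_C_mul, ih, ← mul_assoc, ← C_mul, hq]
    congr 2
    ring

theorem degree_leg (b : ℕ) : (leg b).degree = b := by
  have hm : (X ^ 2 - 1 : ℝ[X]).Monic := by
    rw [← C_1]; exact monic_X_pow_sub_C 1 two_ne_zero
  have hd : (X ^ 2 - 1 : ℝ[X]).natDegree = 2 := by
    rw [← C_1]; exact natDegree_X_pow_sub_C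
  have hmb : ((X ^ 2 - 1 : ℝ[X]) ^ b).natDegree = b * 2 := by rw [hm.natDegree_pow, hd]
  refine le_antisymm ?_ (le_degree_of_ne_zero ?_)
  · refine degree_le_of_natDegree_le ((natDegree_iterate_derivative _ _).trans ?_)
    omega
  · rw [leg, coeff_iterate_derivative]
    have : ((X ^ 2 - 1 : ℝ[X]) ^ b).coeff (b + b) = 1 := by
      have h := (hm.pow b).coeff_natDegree
      rwa [hmb, mul_two] at h
    rw [this, nsmul_eq_mul, mul_one]
    exact_mod_cast (Nat.descFactorial_pos.2 (by omega)).ne'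

theorem natDegree_leg (b : ℕ) : (leg b).natDegree = b :=
  natDegree_eq_of_degree_eq_some (degree_leg b)

theorem leg_ne_zero (b : ℕ) : leg b ≠ 0 := fun h => by
  have := degree_leg b
  simp [h] at this

/-- The Legendre polynomials, as a basis of the space of all polynomials. -/
def legBasis : Module.Basis ℕ ℝ ℝ[X] :=
  Polynomial.Sequence.basis ⟨leg, degree_leg⟩ fun i =>
    isUnit_iff_ne_zero.2 (leadingCoeff_ne_zero.2 (leg_ne_zero i))

theorem legBasis_apply (b : ℕ) : legBasis b = leg b := Polynomial.Sequence.basis_eq_self _ _ b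

theorem exists_eq_sum_leg (q : ℝ[X]) : ∃ (t : Finset ℕ) (c : ℕ → ℝ), q = ∑ j ∈ t, c j • leg j := by
  refine ⟨(legBasis.repr q).support, legBasis.repr q, ?_⟩
  conv_lhs => rw [← legBasis.linearCombination_repr q, Finsupp.linearCombination_apply, Finsupp.sum]
  simp only [legBasis_apply]

/-- The integral of a polynomial over `(-1,1)`. -/
def intPoly (q : ℝ[X]) : ℝ := ∫ x in Set.Ioo (-1 : ℝ) 1, q.eval x

theorem intPoly_eq (q : ℝ[X]) : intPoly q = ∫ x in (-1 : ℝ)..1, q.eval x := by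
  rw [intervalIntegral.integral_of_le (by norm_num), integral_Ioc_eq_integral_Ioo, intPoly]

theorem intPoly_add (p q : ℝ[X]) : intPoly (p + q) = intPoly p + intPoly q := by
  simp only [intPoly_eq, eval_add]
  exact intervalIntegral.integral_add (p.continuous.intervalIntegrable _ _)
    (q.continuous.intervalIntegrable _ _)

theorem intPoly_C_mul (c : ℝ) (p : ℝ[X]) : intPoly (C c * p) = c * intPoly p := by
  simp only [intPoly_eq, eval_mul, eval_C]
  exact intervalIntegral.integral_const_mul _ _

theorem intPoly_derivative (q : ℝ[X]) : intPoly (derivative q) = q.eval 1 - q.eval (-1) := by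
  rw [intPoly_eq]
  exact intervalIntegral.integral_eq_sub_of_hasDerivAt (fun x _ => q.hasDerivAt x)
    ((derivative q).continuous.intervalIntegrable _ _)

/-- Fewer than `e` derivatives of `wt ^ e * f` still leave a factor `wt`, so all boundary terms
vanish. -/
theorem intPoly_by_parts {e j : ℕ} (h : j ≤ e) (f g : ℝ[X]) :
    intPoly (derivative^[j] (wt ^ e * f) * g) =
      (-1) ^ j * intPoly (wt ^ e * f * derivative^[j] g) := by
  induction j generalizing e f with
  | zero => simp
  | succ j ih =>
    obtain ⟨e, rfl⟩ : ∃ k, e = k + 1 := ⟨e - 1, by omega⟩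
    rw [Function.iterate_succ_apply, derivative_wt_pow_mul, ih (by omega),
      ← derivative_wt_pow_mul, Function.iterate_succ_apply' derivative j g]
    have h0 := intPoly_derivative (wt ^ (e + 1) * f * derivative^[j] g)
    rw [derivative_mul, intPoly_add] at h0
    have : (wt.eval (1 : ℝ) = 0) ∧ wt.eval (-1 : ℝ) = 0 := by simp [wt]
    simp only [eval_mul, eval_pow, this.1, this.2] at h0
    rw [zero_pow (Nat.succ_ne_zero e), zero_mul, zero_mul, zero_mul, zero_mul, sub_self] at h0
    rw [pow_succ (-1 : ℝ)]
    linear_combination (-1) ^ j * h0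

theorem intPoly_leg_mul_of_natDegree_lt {b : ℕ} {q : ℝ[X]} (h : q.natDegree < b) :
    intPoly (leg b * q) = 0 := by
  -- The sign accounts for `wt = -(X ^ 2 - 1)`.
  have e : leg b = derivative^[b] (wt ^ b * C ((-1) ^ b)) := by
    rw [leg, wt, C_pow, ← mul_pow]
    congr 2
    simp
  rw [e, intPoly_by_parts le_rfl, iterate_derivative_eq_zero h]
  simp [intPoly]

theorem intPoly_leg_mul_leg {b c : ℕ} (h : b ≠ c) : intPoly (leg b * leg c) = 0 := by
  rcases lt_or_gt_of_ne h with h | h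
  · rw [mul_comm]
    exact intPoly_leg_mul_of_natDegree_lt (by rwa [natDegree_leg])
  · exact intPoly_leg_mul_of_natDegree_lt (by rwa [natDegree_leg])

theorem intPoly_leg_sq_pos (b : ℕ) : 0 < intPoly (leg b * leg b) := by
  rw [intPoly_eq]
  refine intervalIntegral.integral_pos (by norm_num) (leg b * leg b).continuous.continuousOn
    (fun x _ => by rw [eval_mul]; exact mul_self_nonneg _) ?_
  by_contra! hcon
  refine leg_ne_zero b (eq_zero_of_infinite_isRoot _ ?_)
  refine (Set.Icc_infinite (show (-1 : ℝ) < 1 by norm_num)).mono fun x hx => ?_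
  have := hcon x hx
  rw [eval_mul] at this
  exact mul_self_eq_zero.1 (le_antisymm this (mul_self_nonneg _))

theorem intPoly_weighted_leg (a b c : ℕ) :
    intPoly (wt ^ a * derivative^[a] (leg b) * derivative^[a] (leg c)) =
      factQuot b a * intPoly (leg b * leg c) := by
  have h := intPoly_by_parts (le_refl a) (derivative^[a] (leg b)) (leg c)
  rw [iterate_derivative_wt_pow_leg, mul_assoc, intPoly_C_mul] at h
  have h1 : ((-1 : ℝ) ^ a) * (-1) ^ a = 1 := by rw [← mul_pow]; simp
  linear_combination (-1) ^ a * (-h) + (factQuot b a * intPoly (leg b * leg c) -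
    intPoly (wt ^ a * derivative^[a] (leg b) * derivative^[a] (leg c))) * h1

end Legendre


/-! ### Weak derivatives tested against polynomials vanishing on the boundary -/

section Cutoff

open Polynomial Filter Topology
open scoped ContDiff

theorem iterate_deriv_add {f g : ℝ → ℝ} (hf : ContDiff ℝ ∞ f) (hg : ContDiff ℝ ∞ g) (a : ℕ) :
    deriv^[a] (fun x => f x + g x) = fun x => deriv^[a] f x + deriv^[a] g x := by
  induction a generalizing f g with
  | zero => rfl
  | succ a ih =>
    have e : deriv (fun x => f x + g x) = fun x => deriv f x + deriv g x := by
      ext x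
      exact deriv_fun_add (hf.differentiable (by simp) x) (hg.differentiable (by simp) x)
    simp only [Function.iterate_succ_apply, e]
    exact ih (contDiff_infty_iff_deriv.1 hf).2 (contDiff_infty_iff_deriv.1 hg).2

theorem iterate_deriv_congr {f g : ℝ → ℝ} {x : ℝ} (h : f =ᶠ[𝓝 x] g) (a : ℕ) :
    deriv^[a] f x = deriv^[a] g x := by
  rw [← iteratedDeriv_eq_iterate, ← iteratedDeriv_eq_iterate]
  exact h.iteratedDeriv_eq a

theorem iterate_deriv_polynomial (q : ℝ[X]) (a : ℕ) :
    deriv^[a] (fun x => q.eval x) = fun x => (derivative^[a] q).eval x := by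
  induction a generalizing q with
  | zero => rfl
  | succ a ih =>
    have e : deriv (fun x => q.eval x) = fun x => (derivative q).eval x := by
      ext x; exact q.deriv
    simp only [Function.iterate_succ_apply, e, ih]

theorem contDiff_polynomial_eval (q : ℝ[X]) : ContDiff ℝ ∞ fun x : ℝ => q.eval x := by
  simpa using q.contDiff_aeval (𝕜 := ℝ) (n := ∞)

/-- The functions `n^{-e} G(n (1 - x²)) r(x)`. -/
def scaled (e : ℕ) (G : ℝ → ℝ) (r : ℝ[X]) (n : ℕ) (x : ℝ) : ℝ :=
  ((n : ℝ)⁻¹) ^ e * G (n * (1 - x ^ 2)) * r.eval x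

theorem contDiff_scaled {e : ℕ} {G : ℝ → ℝ} (hG : ContDiff ℝ ∞ G) (r : ℝ[X]) (n : ℕ) :
    ContDiff ℝ ∞ (scaled e G r n) := by
  unfold scaled
  refine ContDiff.mul (contDiff_const.mul (hG.comp ?_)) (contDiff_polynomial_eval r)
  fun_prop

theorem deriv_scaled {e : ℕ} {G : ℝ → ℝ} (hG : ContDiff ℝ ∞ G) (r : ℝ[X]) {n : ℕ} (hn : n ≠ 0) :
    deriv (scaled (e + 1) G r n) =
      fun x => scaled e (deriv G) (-(2 * X) * r) n x + scaled (e + 1) G (derivative r) n x := by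
  ext x
  have h1 : HasDerivAt (fun x : ℝ => (n : ℝ) * (1 - x ^ 2)) (n * (-(2 * x))) x := by
    have := (((hasDerivAt_id x).pow 2).const_sub 1).const_mul (n : ℝ)
    simpa using this
  have h2 : HasDerivAt G (deriv G (n * (1 - x ^ 2))) (n * (1 - x ^ 2)) :=
    (hG.differentiable (by simp) _).hasDerivAt
  have h3 := (((h2.comp x h1).const_mul (((n : ℝ)⁻¹) ^ (e + 1))).mul (r.hasDerivAt x)).deriv
  have h4 : scaled (e + 1) G r n = (fun y => ((n : ℝ)⁻¹) ^ (e + 1) *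
      (G ∘ fun x : ℝ => (n : ℝ) * (1 - x ^ 2)) y) * fun x => r.eval x := rfl
  rw [h4, h3]
  have hn' : (n : ℝ) ≠ 0 := by exact_mod_cast hn
  simp only [scaled, Function.comp, pow_succ, eval_mul, eval_neg, eval_X]
  norm_num
  field_simp

/-- Each derivative falling on `G (n (1 - x²))` costs a factor `n`, paid for by one of the `e`
factors `n⁻¹`. The profile is left general because `G'` behaves like a power of degree one less, so
the induction closes. -/
theorem exists_bound_scaled (a : ℕ) : ∀ (e : ℕ) (G : ℝ → ℝ) (K : ℝ) (r : ℝ[X]), a ≤ e →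
    ContDiff ℝ ∞ G → (∀ t, 2 < t → G t = K * t ^ e) →
    ∃ C, ∀ n : ℕ, n ≠ 0 → ∀ x ∈ Set.Icc (-1 : ℝ) 1, |deriv^[a] (scaled e G r n) x| ≤ C := by
  induction a with
  | zero =>
    intro e G K r _ hG hK
    obtain ⟨A, hA⟩ := (isCompact_Icc (a := (0 : ℝ)) (b := 2)).exists_bound_of_continuousOn
      hG.continuous.continuousOn
    obtain ⟨B, hB⟩ := (isCompact_Icc (a := (-1 : ℝ)) (b := 1)).exists_bound_of_continuousOn
      r.continuous.continuousOn
    refine ⟨max A |K| * B, fun n hn x hx => ?_⟩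
    have hn1 : (1 : ℝ) ≤ n := by exact_mod_cast Nat.one_le_iff_ne_zero.2 hn
    have hn0 : (0 : ℝ) < n := by linarith
    have hw0 : 0 ≤ 1 - x ^ 2 := by nlinarith [hx.1, hx.2]
    have hw1 : 1 - x ^ 2 ≤ 1 := by nlinarith [sq_nonneg x]
    have hr := hB x hx
    rw [Real.norm_eq_abs] at hr
    rw [Function.iterate_zero_apply, scaled, abs_mul]
    refine mul_le_mul ?_ hr (abs_nonneg _) (le_max_of_le_right (abs_nonneg _))
    rcases le_or_gt (n * (1 - x ^ 2)) 2 with h | h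
    · refine le_trans ?_ (le_max_left _ _)
      have := hA _ (show n * (1 - x ^ 2) ∈ Set.Icc (0 : ℝ) 2 from ⟨by positivity, h⟩)
      rw [Real.norm_eq_abs] at this
      rw [abs_mul, abs_of_nonneg (by positivity : (0 : ℝ) ≤ ((n : ℝ)⁻¹) ^ e)]
      have h1 : ((n : ℝ)⁻¹) ^ e ≤ 1 := pow_le_one₀ (by positivity) (inv_le_one_of_one_le₀ hn1)
      calc _ ≤ 1 * |G (n * (1 - x ^ 2))| := by gcongr
        _ ≤ A := by rwa [one_mul]
    · refine le_trans ?_ (le_max_right _ _)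
      rw [hK _ h, mul_pow]
      have : ((n : ℝ)⁻¹) ^ e * (K * ((n : ℝ) ^ e * (1 - x ^ 2) ^ e)) = K * (1 - x ^ 2) ^ e := by
        rw [inv_pow]; field_simp
      rw [this, abs_mul, abs_of_nonneg (by positivity : 0 ≤ (1 - x ^ 2) ^ e)]
      exact mul_le_of_le_one_right (abs_nonneg _) (pow_le_one₀ hw0 hw1)
  | succ a ih =>
    intro e G K r hae hG hK
    obtain ⟨e, rfl⟩ : ∃ k, e = k + 1 := ⟨e - 1, by omega⟩
    have hG' : ContDiff ℝ ∞ (deriv G) := (contDiff_infty_iff_deriv.1 hG).2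
    -- The strict inequality `2 < t` makes the power law hold near `t`, so it can be differentiated.
    obtain ⟨C₁, h₁⟩ := ih e (deriv G) (K * (e + 1)) (-(2 * X) * r) (by omega) hG' (by
      intro t ht
      have : G =ᶠ[𝓝 t] fun t => K * t ^ (e + 1) := by
        filter_upwards [lt_mem_nhds ht] with s hs using hK s hs
      rw [this.deriv_eq, ((hasDerivAt_pow (e + 1) t).const_mul K).deriv]
      simp
      ring)
    obtain ⟨C₂, h₂⟩ := ih (e + 1) G K (derivative r) (by omega) hG hK
    refine ⟨C₁ + C₂, fun n hn x hx => ?_⟩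
    rw [Function.iterate_succ_apply, deriv_scaled hG r hn,
      iterate_deriv_add (contDiff_scaled hG' _ n) (contDiff_scaled hG _ n)]
    exact (abs_add_le _ _).trans (add_le_add (h₁ n hn x hx) (h₂ n hn x hx))

/-- The profile `t ↦ t^e χ(t)`, where `χ` is a smooth transition from `0` to `1` on `[1,2]`. -/
def profile (e : ℕ) (t : ℝ) : ℝ := t ^ e * Real.smoothTransition (t - 1)

theorem contDiff_profile (e : ℕ) : ContDiff ℝ ∞ (profile e) := by
  unfold profile
  exact (contDiff_id.pow e).mul (Real.smoothTransition.contDiff.comp (contDiff_id.sub contDiff_const))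

theorem profile_of_le {e : ℕ} {t : ℝ} (h : t ≤ 1) : profile e t = 0 := by
  rw [profile, Real.smoothTransition.zero_of_nonpos (by linarith), mul_zero]

theorem profile_of_ge {e : ℕ} {t : ℝ} (h : 2 ≤ t) : profile e t = t ^ e := by
  rw [profile, Real.smoothTransition.one_of_one_le (by linarith), mul_one]

/-- Smooth compactly supported approximations of the polynomial `(1 - x²)^e r(x)`. -/
def cutoff (e : ℕ) (r : ℝ[X]) (n : ℕ) : ℝ → ℝ := scaled e (profile e) r (n + 1)

theorem contDiff_cutoff (e : ℕ) (r : ℝ[X]) (n : ℕ) : ContDiff ℝ ∞ (cutoff e r n) :=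
  contDiff_scaled (contDiff_profile e) r _

theorem exists_bound_cutoff {a e : ℕ} (h : a ≤ e) (r : ℝ[X]) :
    ∃ C, ∀ n : ℕ, ∀ x ∈ Set.Ioo (-1 : ℝ) 1, |deriv^[a] (cutoff e r n) x| ≤ C := by
  obtain ⟨C, hC⟩ := exists_bound_scaled a e (profile e) 1 r h (contDiff_profile e)
    fun t ht => by rw [profile_of_ge ht.le, one_mul]
  exact ⟨C, fun n x hx => hC (n + 1) (Nat.succ_ne_zero n) x (Set.Ioo_subset_Icc_self hx)⟩

theorem tendsto_cutoff (a e : ℕ) (r : ℝ[X]) {x : ℝ} (hx : x ∈ Set.Ioo (-1 : ℝ) 1) :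
    Tendsto (fun n => deriv^[a] (cutoff e r n) x) atTop
      (𝓝 ((derivative^[a] (wt ^ e * r)).eval x)) := by
  have hw : 0 < 1 - x ^ 2 := by nlinarith [hx.1, hx.2]
  obtain ⟨N, hN⟩ := exists_nat_gt (2 / (1 - x ^ 2))
  -- At a fixed interior point the sequence is eventually constant, since the cutoff equals the
  -- polynomial near `x` for large `n`.
  refine tendsto_const_nhds.congr' ?_
  filter_upwards [eventually_ge_atTop N] with n hn
  have hlt : 2 < ((n + 1 : ℕ) : ℝ) * (1 - x ^ 2) := by
    rw [div_lt_iff₀ hw] at hN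
    refine hN.trans_le ?_
    gcongr
    omega
  have hev : cutoff e r n =ᶠ[𝓝 x] fun y => (wt ^ e * r).eval y := by
    have hc : ContinuousAt (fun y : ℝ => ((n + 1 : ℕ) : ℝ) * (1 - y ^ 2)) x := by fun_prop
    filter_upwards [hc.eventually (lt_mem_nhds hlt)] with y hy
    have hn0 : ((n + 1 : ℕ) : ℝ) ≠ 0 := by positivity
    rw [cutoff, scaled, profile_of_ge hy.le, mul_pow, ← mul_assoc, ← mul_pow, inv_mul_cancel₀ hn0]
    simp [wt]
  rw [iterate_deriv_congr hev, iterate_deriv_polynomial]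

theorem exists_compact_support_cutoff (e : ℕ) (r : ℝ[X]) (n : ℕ) :
    ∃ K : Set ℝ, IsCompact K ∧ K ⊆ Set.Ioo (-1) 1 ∧ ∀ x ∉ K, cutoff e r n x = 0 := by
  have hn : (0 : ℝ) < ((n + 1 : ℕ) : ℝ) := by positivity
  refine ⟨{x | 1 ≤ ((n + 1 : ℕ) : ℝ) * (1 - x ^ 2)}, ?_, ?_, ?_⟩
  · refine Metric.isCompact_of_isClosed_isBounded
      (isClosed_le continuous_const (by fun_prop)) ((Metric.isBounded_Icc (-1 : ℝ) 1).subset ?_)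
    intro x hx
    have hx' : 1 ≤ ((n + 1 : ℕ) : ℝ) * (1 - x ^ 2) := hx
    have : 0 < 1 - x ^ 2 := pos_of_mul_pos_right (by linarith) hn.le
    constructor <;> nlinarith
  · intro x hx
    have hx' : 1 ≤ ((n + 1 : ℕ) : ℝ) * (1 - x ^ 2) := hx
    have : 0 < 1 - x ^ 2 := pos_of_mul_pos_right (by linarith) hn.le
    constructor <;> nlinarith
  · intro x hx
    have hx' : ((n + 1 : ℕ) : ℝ) * (1 - x ^ 2) < 1 := not_le.1 hx
    rw [cutoff, scaled, profile_of_le hx'.le]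
    simp

end Cutoff

/-! ### Tensor products of one-dimensional cutoffs and integration by parts on the cube -/

section ProductFunctions

open Filter Topology
open scoped ContDiff

theorem partialDeriv_prod {d : ℕ} (k : Fin d) (f : Fin d → ℝ → ℝ)
    (hf : ∀ j, Differentiable ℝ (f j)) :
    partialDeriv k (fun x => ∏ j, f j (x j)) =
      fun x => ∏ j, Function.update f k (deriv (f k)) j (x j) := by
  ext x
  have h : ∀ j ∈ (Finset.univ : Finset (Fin d)), HasFDerivAt (fun x : Fin d → ℝ => f j (x j))
      (deriv (f j) (x j) • (ContinuousLinearMap.proj j : (Fin d → ℝ) →L[ℝ] ℝ)) x := by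
    intro j _
    exact (hf j (x j)).hasDerivAt.comp_hasFDerivAt x
      (ContinuousLinearMap.proj (R := ℝ) (φ := fun _ : Fin d => ℝ) j).hasFDerivAt
  rw [partialDeriv, (HasFDerivAt.finsetProd h).fderiv, _root_.sum_apply,
    Finset.sum_eq_single k]
  · rw [← Finset.mul_prod_erase _ _ (Finset.mem_univ k), Function.update_self]
    have : ∏ j ∈ Finset.univ.erase k, Function.update f k (deriv (f k)) j (x j) =
        ∏ j ∈ Finset.univ.erase k, f j (x j) :=
      Finset.prod_congr rfl fun j hj => by rw [Function.update_of_ne (Finset.ne_of_mem_erase hj)]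
    rw [this]
    simp [mul_comm]
  · intro j _ hj
    simp [hj]
  · simp

theorem iterate_partialDeriv_prod {d : ℕ} (k : Fin d) (m : ℕ) (f : Fin d → ℝ → ℝ)
    (hf : ∀ j, ContDiff ℝ ∞ (f j)) :
    (partialDeriv k)^[m] (fun x => ∏ j, f j (x j)) =
      fun x => ∏ j, Function.update f k (deriv^[m] (f k)) j (x j) := by
  induction m generalizing f with
  | zero => simp
  | succ m ih =>
    rw [Function.iterate_succ_apply, partialDeriv_prod k f fun j => (hf j).differentiable (by simp),
      ih]
    · simp
    · intro j
      rcases eq_or_ne j k with rfl | h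
      · rw [Function.update_self]; exact (contDiff_infty_iff_deriv.1 (hf j)).2
      · rw [Function.update_of_ne h]; exact hf j

theorem mixedDeriv_prod {d : ℕ} (α : Fin d → ℕ) (f : Fin d → ℝ → ℝ)
    (hf : ∀ j, ContDiff ℝ ∞ (f j)) :
    mixedDeriv α (fun x => ∏ j, f j (x j)) = fun x => ∏ j, deriv^[α j] (f j) (x j) := by
  have key : ∀ l : List (Fin d), l.Nodup →
      l.foldr (fun k g => (partialDeriv k)^[α k] g) (fun x => ∏ j, f j (x j)) =
        fun x => ∏ j, (if j ∈ l then deriv^[α j] (f j) else f j) (x j) := by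
    intro l hl
    induction l with
    | nil => simp
    | cons k l ih =>
      rw [List.nodup_cons] at hl
      rw [List.foldr_cons, ih hl.2, iterate_partialDeriv_prod]
      · ext x
        refine Finset.prod_congr rfl fun j _ => ?_
        rcases eq_or_ne j k with rfl | h
        · simp [hl.1]
        · simp [h]
      · intro j
        split_ifs
        · exact ContDiff.iterate_deriv _ (hf j)
        · exact hf j
  rw [mixedDeriv, key _ (List.nodup_finRange d)]
  simp

/-- The product of the cutoffs in all coordinate directions, as a test function. -/
def cutoffTest {d : ℕ} (e : Fin d → ℕ) (r : Fin d → Polynomial ℝ) (n : ℕ) :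
    TestFunction (cube d) ℝ ⊤ := by
  have hex := fun k => exists_compact_support_cutoff (e k) (r k) n
  have hcpt : IsCompact (Set.univ.pi fun k => (hex k).choose) :=
    isCompact_univ_pi fun k => (hex k).choose_spec.1
  have hsub : Function.support (fun x : Fin d → ℝ => ∏ k, cutoff (e k) (r k) n (x k)) ⊆
      Set.univ.pi fun k => (hex k).choose := by
    intro x hx k _
    by_contra hk
    exact hx (Finset.prod_eq_zero (Finset.mem_univ k) ((hex k).choose_spec.2.2 _ hk))
  exact
  { toFun := fun x => ∏ k, cutoff (e k) (r k) n (x k)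
    contDiff' := contDiff_prod fun k _ =>
      (contDiff_cutoff (e k) (r k) n).comp (contDiff_apply ℝ ℝ k)
    hasCompactSupport' := HasCompactSupport.of_support_subset_isCompact hcpt hsub
    tsupport_subset' := (closure_minimal hsub hcpt.isClosed).trans
      (Set.pi_mono fun k _ => (hex k).choose_spec.2.1) }

theorem cutoffTest_apply {d : ℕ} (e : Fin d → ℕ) (r : Fin d → Polynomial ℝ) (n : ℕ) :
    ⇑(cutoffTest e r n) = fun x => ∏ k, cutoff (e k) (r k) n (x k) := rfl

/-- Dominated convergence, with the uniform bounds of `exists_bound_cutoff`. The cases `a = e` and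
`a = 0` serve the two sides of the weak derivative identity. -/
theorem tendsto_integral_cutoff {d : ℕ} {a e : Fin d → ℕ} (h : ∀ k, a k ≤ e k)
    (r : Fin d → Polynomial ℝ) {u : (Fin d → ℝ) → ℝ}
    (hu : IntegrableOn u (cube d : Set (Fin d → ℝ))) :
    Tendsto (fun n => ∫ x in (cube d : Set (Fin d → ℝ)),
        u x * ∏ k, deriv^[a k] (cutoff (e k) (r k) n) (x k)) atTop
      (𝓝 (∫ x in (cube d : Set (Fin d → ℝ)),
        u x * ∏ k, (Polynomial.derivative^[a k] (wt ^ e k * r k)).eval (x k))) := by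
  choose C hC using fun k => exists_bound_cutoff (h k) (r k)
  have hmeas : MeasurableSet (cube d : Set (Fin d → ℝ)) := (cube d).isOpen.measurableSet
  refine tendsto_integral_of_dominated_convergence (fun x => ‖u x‖ * ∏ k, C k) ?_ ?_ ?_ ?_
  · intro n
    refine hu.aestronglyMeasurable.mul (Continuous.aestronglyMeasurable ?_)
    refine continuous_finsetProd _ fun k _ => ?_
    exact (ContDiff.iterate_deriv _ (contDiff_cutoff (e k) (r k) n)).continuous.comp
      (continuous_apply k)
  · exact hu.norm.mul_const _
  · intro n
    refine ae_restrict_of_forall_mem hmeas fun x hx => ?_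
    rw [norm_mul, norm_prod]
    refine mul_le_mul_of_nonneg_left ?_ (norm_nonneg _)
    exact Finset.prod_le_prod (fun _ _ => norm_nonneg _)
      fun k _ => hC k n (x k) (hx k (Set.mem_univ k))
  · refine ae_restrict_of_forall_mem hmeas fun x hx => ?_
    exact (tendsto_finsetProd _ fun k _ =>
      tendsto_cutoff (a k) (e k) (r k) (hx k (Set.mem_univ k))).const_mul _

/-- Integration by parts for weak derivatives against polynomials of product form which vanish on
the boundary to the order of the derivative. -/
theorem IsWeakDeriv.integral_polynomial {d : ℕ} {α : Fin d → ℕ} {u v : (Fin d → ℝ) → ℝ}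
    (h : IsWeakDeriv α u v) (hu : IntegrableOn u (cube d : Set (Fin d → ℝ)))
    (hv : IntegrableOn v (cube d : Set (Fin d → ℝ))) (r : Fin d → Polynomial ℝ) :
    ∫ x in (cube d : Set (Fin d → ℝ)),
        u x * ∏ k, (Polynomial.derivative^[α k] (wt ^ α k * r k)).eval (x k) =
      (-1) ^ (∑ k, α k) * ∫ x in (cube d : Set (Fin d → ℝ)),
        v x * ∏ k, (wt ^ α k * r k).eval (x k) := by
  have h1 := tendsto_integral_cutoff (fun k => le_refl (α k)) r hu
  have h2 := (tendsto_integral_cutoff (a := fun _ => 0) (e := α) (fun k => Nat.zero_le _) r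
    hv).const_mul ((-1 : ℝ) ^ (∑ k, α k))
  refine tendsto_nhds_unique h1 (h2.congr fun n => ?_)
  have := h.integral_eq (cutoffTest α r n)
  rw [cutoffTest_apply, mixedDeriv_prod α _ fun k => contDiff_cutoff (α k) (r k) n] at this
  exact this.symm

end ProductFunctions


/-! ### The tensor product Legendre basis of `L²` -/

section L2Basis

open Filter Topology

instance (d : ℕ) : IsFiniteMeasure (cubeMeasure d) := by
  refine ⟨?_⟩
  rw [Measure.restrict_apply_univ]
  refine lt_of_le_of_lt (measure_mono (t := Set.Icc (fun _ => -1) (fun _ => 1)) ?_)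
    isCompact_Icc.measure_lt_top
  exact fun x hx => ⟨fun k => (hx k (Set.mem_univ k)).1.le, fun k => (hx k (Set.mem_univ k)).2.le⟩

theorem measurableSet_cube (d : ℕ) : MeasurableSet (cube d : Set (Fin d → ℝ)) :=
  (cube d).isOpen.measurableSet

theorem inner_toLp {X : Type*} [MeasurableSpace X] {μ : Measure X} {f g : X → ℝ}
    (hf : MemLp f 2 μ) (hg : MemLp g 2 μ) :
    inner ℝ (hf.toLp f) (hg.toLp g) = ∫ x, f x * g x ∂μ := by
  rw [L2.inner_def]
  refine integral_congr_ae ?_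
  filter_upwards [hf.coeFn_toLp, hg.coeFn_toLp] with x h1 h2
  rw [h1, h2]
  simp [mul_comm]

theorem integral_cube_prod {d : ℕ} (f : Fin d → ℝ → ℝ) :
    ∫ x in (cube d : Set (Fin d → ℝ)), ∏ k, f k (x k) =
      ∏ k, ∫ x in Set.Ioo (-1 : ℝ) 1, f k x := by
  have h : cubeMeasure d = Measure.pi fun _ : Fin d => volume.restrict (Set.Ioo (-1 : ℝ) 1) := by
    rw [cubeMeasure, volume_pi]
    exact Measure.restrict_pi_pi _ _
  change ∫ x, ∏ k, f k (x k) ∂cubeMeasure d = _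
  rw [h]
  exact integral_fintype_prod_eq_prod (μ := fun _ : Fin d => volume.restrict (Set.Ioo (-1 : ℝ) 1)) f

/-- The polynomial `∏_k r_k(x_k)` in `d` variables. -/
def prodPoly {d : ℕ} (r : Fin d → Polynomial ℝ) : MvPolynomial (Fin d) ℝ :=
  ∏ k, Polynomial.toMvPolynomial k (r k)

theorem eval_prodPoly {d : ℕ} (r : Fin d → Polynomial ℝ) (x : Fin d → ℝ) :
    MvPolynomial.eval x (prodPoly r) = ∏ k, (r k).eval (x k) := by
  simp [prodPoly, MvPolynomial.eval_toMvPolynomial]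

theorem totalDegree_toMvPolynomial_le {σ : Type*} (i : σ) (q : Polynomial ℝ) :
    (Polynomial.toMvPolynomial i q).totalDegree ≤ q.natDegree := by
  conv_lhs => rw [q.as_sum_range_C_mul_X_pow, map_sum]
  refine (MvPolynomial.totalDegree_finsetSum _ _).trans (Finset.sup_le fun j hj => ?_)
  rw [map_mul, map_pow, Polynomial.toMvPolynomial_C, Polynomial.toMvPolynomial_X]
  refine (MvPolynomial.totalDegree_mul _ _).trans ?_
  rw [MvPolynomial.totalDegree_C, MvPolynomial.totalDegree_X_pow, zero_add]
  exact Nat.lt_succ_iff.1 (Finset.mem_range.1 hj)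

theorem totalDegree_prodPoly_le {d : ℕ} (r : Fin d → Polynomial ℝ) :
    (prodPoly r).totalDegree ≤ ∑ k, (r k).natDegree :=
  (MvPolynomial.totalDegree_finsetProd _ _).trans
    (Finset.sum_le_sum fun k _ => totalDegree_toMvPolynomial_le k (r k))

theorem integral_prodPoly {d : ℕ} (r : Fin d → Polynomial ℝ) :
    ∫ x in (cube d : Set (Fin d → ℝ)), ∏ k, (r k).eval (x k) = ∏ k, intPoly (r k) :=
  integral_cube_prod fun k x => (r k).eval x

/-- The tensor product Legendre polynomial, as an element of `L²`. -/
def legL2 {d : ℕ} (β : Fin d → ℕ) : L2Cube d := polyToL2 d (prodPoly fun k => leg (β k))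

theorem inner_polyToL2 {d : ℕ} (q r : MvPolynomial (Fin d) ℝ) :
    inner ℝ (polyToL2 d q) (polyToL2 d r) =
      ∫ x in (cube d : Set (Fin d → ℝ)), MvPolynomial.eval x q * MvPolynomial.eval x r :=
  inner_toLp (memLp_polynomial q) (memLp_polynomial r)

theorem inner_prodPoly {d : ℕ} (q r : Fin d → Polynomial ℝ) :
    inner ℝ (polyToL2 d (prodPoly q)) (polyToL2 d (prodPoly r)) = ∏ k, intPoly (q k * r k) := by
  rw [inner_polyToL2, ← integral_prodPoly]
  simp only [eval_prodPoly, ← Finset.prod_mul_distrib, Polynomial.eval_mul]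

theorem inner_polyToL2_Lp {d : ℕ} (q : MvPolynomial (Fin d) ℝ) (u : L2Cube d) :
    inner ℝ (polyToL2 d q) u =
      ∫ x in (cube d : Set (Fin d → ℝ)), u x * MvPolynomial.eval x q := by
  conv_lhs => rw [← Lp.toLp_coeFn u (Lp.memLp u)]
  refine (inner_toLp (memLp_polynomial q) (Lp.memLp u)).trans ?_
  simp only [mul_comm]

theorem inner_legL2_of_ne {d : ℕ} {β γ : Fin d → ℕ} (h : β ≠ γ) :
    inner ℝ (legL2 β) (legL2 γ) = 0 := by
  obtain ⟨k, hk⟩ := Function.ne_iff.1 h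
  rw [legL2, legL2, inner_prodPoly]
  exact Finset.prod_eq_zero (Finset.mem_univ k) (intPoly_leg_mul_leg hk)

theorem norm_legL2_sq {d : ℕ} (β : Fin d → ℕ) :
    ‖legL2 β‖ ^ 2 = ∏ k, intPoly (leg (β k) * leg (β k)) := by
  rw [← real_inner_self_eq_norm_sq, legL2, inner_prodPoly]

theorem norm_legL2_pos {d : ℕ} (β : Fin d → ℕ) : 0 < ‖legL2 β‖ := by
  have h : 0 < ‖legL2 β‖ ^ 2 := by
    rw [norm_legL2_sq]
    exact Finset.prod_pos fun k _ => intPoly_leg_sq_pos _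
  exact norm_pos_iff.2 fun h0 => by simp [h0] at h

theorem legL2_mem_polySpace {d p : ℕ} {β : Fin d → ℕ} (h : ∑ k, β k ≤ p) :
    legL2 β ∈ polySpace d p := by
  refine Submodule.mem_map_of_mem ?_
  rw [MvPolynomial.mem_restrictTotalDegree]
  refine (totalDegree_prodPoly_le _).trans ?_
  simpa only [natDegree_leg] using h

theorem monomial_eq_prodPoly {d : ℕ} (γ : Fin d →₀ ℕ) :
    MvPolynomial.monomial γ (1 : ℝ) = prodPoly fun k => Polynomial.X ^ γ k := by
  rw [MvPolynomial.monomial_eq, prodPoly]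
  simp [Finsupp.prod_fintype]

theorem inner_legL2_of_mem_polySpace {d p : ℕ} {β : Fin d → ℕ} (h : p < ∑ k, β k) {w : L2Cube d}
    (hw : w ∈ polySpace d p) : inner ℝ (legL2 β) w = 0 := by
  obtain ⟨q, hq, rfl⟩ := hw
  rw [SetLike.mem_coe, MvPolynomial.mem_restrictTotalDegree] at hq
  rw [q.as_sum, map_sum, inner_sum]
  refine Finset.sum_eq_zero fun γ hγ => ?_
  have hdeg : ∑ k, γ k < ∑ k, β k := by
    refine lt_of_le_of_lt ?_ (hq.trans_lt h)
    have := MvPolynomial.le_totalDegree hγ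
    rwa [Finsupp.sum_fintype _ _ fun _ => rfl] at this
  -- A monomial of total degree below `|β|` has degree below `β k` in some variable, and that
  -- one-dimensional factor integrates to zero.
  obtain ⟨k, _, hk⟩ := Finset.exists_lt_of_sum_lt hdeg
  rw [← mul_one (MvPolynomial.coeff γ q), ← smul_eq_mul, ← MvPolynomial.smul_monomial, map_smul,
    inner_smul_right, monomial_eq_prodPoly, legL2, inner_prodPoly,
    Finset.prod_eq_zero (Finset.mem_univ k), mul_zero]
  exact intPoly_leg_mul_of_natDegree_lt (by rwa [Polynomial.natDegree_X_pow])

theorem prodPoly_mem_span {d : ℕ} (r : Fin d → Polynomial ℝ) :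
    prodPoly r ∈ Submodule.span ℝ
      (Set.range fun β : Fin d → ℕ => prodPoly fun k => leg (β k)) := by
  choose t c h using fun k => exists_eq_sum_leg (r k)
  have e : prodPoly r = ∑ β ∈ Fintype.piFinset t, (∏ k, c k (β k)) •
      prodPoly fun k => leg (β k) := by
    conv_lhs => rw [prodPoly, Finset.prod_congr rfl fun k _ => by rw [h k, map_sum]]
    rw [Finset.prod_univ_sum]
    refine Finset.sum_congr rfl fun β _ => ?_
    simp only [map_smul, prodPoly, MvPolynomial.smul_eq_C_mul, Finset.prod_mul_distrib, map_prod]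
  rw [e]
  exact Submodule.sum_mem _ fun β _ => Submodule.smul_mem _ _ (Submodule.subset_span ⟨β, rfl⟩)

theorem polyToL2_mem_span {d : ℕ} (q : MvPolynomial (Fin d) ℝ) :
    polyToL2 d q ∈ Submodule.span ℝ (Set.range (legL2 (d := d))) := by
  have h : q ∈ Submodule.span ℝ
      (Set.range fun β : Fin d → ℕ => prodPoly fun k => leg (β k)) := by
    rw [q.as_sum]
    refine Submodule.sum_mem _ fun γ _ => ?_
    rw [← mul_one (MvPolynomial.coeff γ q), ← smul_eq_mul, ← MvPolynomial.smul_monomial,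
      monomial_eq_prodPoly]
    exact Submodule.smul_mem _ _ (prodPoly_mem_span _)
  have h2 := Submodule.mem_map_of_mem (f := polyToL2 d) h
  rw [Submodule.map_span, ← Set.range_comp] at h2
  exact h2

theorem exists_polynomial_near {d : ℕ} {g : (Fin d → ℝ) → ℝ} (hg : Continuous g) {ε : ℝ}
    (hε : 0 < ε) : ∃ q : MvPolynomial (Fin d) ℝ,
      ∀ x ∈ (cube d : Set (Fin d → ℝ)), ‖MvPolynomial.eval x q - g x‖ < ε := by
  set F : MvPolynomial (Fin d) ℝ →ₐ[ℝ] C(Fin d → ℝ, ℝ) :=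
    MvPolynomial.aeval fun k => ⟨fun x => x k, continuous_apply k⟩ with hF
  have hFx : ∀ q x, F q x = MvPolynomial.eval x q := by
    intro q x
    induction q using MvPolynomial.induction_on with
    | C a => rw [hF, MvPolynomial.aeval_C, MvPolynomial.eval_C]; rfl
    | add p q hp hq => rw [map_add, map_add, ← hp, ← hq]; rfl
    | mul_X p k hp =>
      rw [map_mul, map_mul, MvPolynomial.eval_X, ← hp, hF, MvPolynomial.aeval_X]; rfl
  have hsep : F.range.SeparatesPoints := by
    intro x y hxy
    obtain ⟨k, hk⟩ := Function.ne_iff.1 hxy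
    refine ⟨_, ⟨F (MvPolynomial.X k), ⟨_, rfl⟩, rfl⟩, ?_⟩
    simpa [hFx] using hk
  obtain ⟨G, ⟨q, rfl⟩, h⟩ :=
    ContinuousMap.exists_mem_subalgebra_near_continuous_of_isCompact_of_separatesPoints hsep ⟨g, hg⟩
      (isCompact_Icc (a := fun _ : Fin d => (-1 : ℝ)) (b := fun _ => 1)) hε
  refine ⟨q, fun x hx => ?_⟩
  have := h x ⟨fun k => (hx k (Set.mem_univ k)).1.le, fun k => (hx k (Set.mem_univ k)).2.le⟩
  rw [← hFx]
  exact this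

/-- A function orthogonal to all polynomials vanishes. -/
theorem eq_zero_of_inner_polyToL2 {d : ℕ} {f : L2Cube d}
    (h : ∀ q, inner ℝ (polyToL2 d q) f = 0) : f = 0 := by
  have hint : Integrable f (cubeMeasure d) := (Lp.memLp f).integrable one_le_two
  rw [Lp.eq_zero_iff_ae_eq_zero]
  refine ae_eq_zero_of_integral_contDiff_smul_eq_zero hint.locallyIntegrable fun g hg _ => ?_
  by_contra hI
  set I := ∫ x, g x • f x ∂cubeMeasure d with hIdef
  set M := ∫ x, ‖f x‖ ∂cubeMeasure d with hM
  have hM0 : 0 ≤ M := integral_nonneg fun x => norm_nonneg _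
  have hI0 : 0 < |I| := abs_pos.2 hI
  -- With this accuracy, orthogonality to `q` forces `|I| ≤ |I| M / (M + 1)`, impossible for `I ≠
  -- 0`.
  obtain ⟨q, hq⟩ := exists_polynomial_near hg.continuous (show 0 < |I| / (M + 1) by positivity)
  have hq0 := h q
  rw [inner_polyToL2_Lp] at hq0
  have hdiff : ∀ᵐ x ∂cubeMeasure d,
      ‖(MvPolynomial.eval x q - g x) * f x‖ ≤ |I| / (M + 1) * ‖f x‖ :=
    ae_restrict_of_forall_mem (measurableSet_cube d) fun x hx => by
      rw [norm_mul]
      exact mul_le_mul_of_nonneg_right (hq x hx).le (norm_nonneg _)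
  have hqf : Integrable (fun x => f x * MvPolynomial.eval x q) (cubeMeasure d) :=
    (Lp.memLp f).integrable_mul (memLp_polynomial q)
  have hdi : Integrable (fun x => (MvPolynomial.eval x q - g x) * f x) (cubeMeasure d) :=
    (hint.norm.const_mul _).mono'
      (((MvPolynomial.continuous_eval q).sub hg.continuous).aestronglyMeasurable.mul
        hint.aestronglyMeasurable) hdiff
  have e : I = -∫ x, (MvPolynomial.eval x q - g x) * f x ∂cubeMeasure d := by
    have e2 : I = ∫ x, f x * MvPolynomial.eval x q - (MvPolynomial.eval x q - g x) * f x
        ∂cubeMeasure d := by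
      rw [hIdef]
      congr 1
      ext x
      rw [smul_eq_mul]
      ring
    rw [e2, integral_sub hqf hdi, hq0, zero_sub]
  have hle : |I| ≤ |I| / (M + 1) * M := by
    conv_lhs => rw [e, abs_neg]
    refine (norm_integral_le_of_norm_le (hint.norm.const_mul (|I| / (M + 1))) hdiff).trans_eq ?_
    rw [integral_const_mul]
  rw [div_mul_eq_mul_div, le_div_iff₀ (by positivity)] at hle
  linarith

/-- The normalized tensor product Legendre polynomials. -/
def normLeg {d : ℕ} (β : Fin d → ℕ) : L2Cube d := ‖legL2 β‖⁻¹ • legL2 β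

theorem inner_normLeg {d : ℕ} (β : Fin d → ℕ) (u : L2Cube d) :
    inner ℝ (normLeg β) u = ‖legL2 β‖⁻¹ * inner ℝ (legL2 β) u :=
  real_inner_smul_left _ _ _

theorem orthonormal_normLeg (d : ℕ) : Orthonormal ℝ (normLeg (d := d)) := by
  refine ⟨fun β => ?_, fun β γ h => ?_⟩
  · rw [normLeg, norm_smul, norm_inv, norm_norm, inv_mul_cancel₀ (norm_legL2_pos β).ne']
  · change inner ℝ (normLeg β) (normLeg γ) = 0
    rw [inner_normLeg, real_inner_comm, inner_normLeg, inner_legL2_of_ne h.symm, mul_zero, mul_zero]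

/-- The Hilbert basis of `L²` of normalized tensor product Legendre polynomials. -/
def legHilbertBasis (d : ℕ) : HilbertBasis (Fin d → ℕ) ℝ (L2Cube d) :=
  HilbertBasis.mkOfOrthogonalEqBot (orthonormal_normLeg d) (by
    rw [Submodule.eq_bot_iff]
    intro f hf
    have hleg : ∀ β, inner ℝ (legL2 β) f = 0 := by
      intro β
      have h : inner ℝ (normLeg β) f = 0 :=
        (Submodule.mem_orthogonal _ _).1 hf _ (Submodule.subset_span ⟨β, rfl⟩)
      rw [inner_normLeg] at h
      exact (mul_eq_zero.1 h).resolve_left (inv_ne_zero (norm_legL2_pos β).ne')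
    refine eq_zero_of_inner_polyToL2 fun q => ?_
    have hle : Submodule.span ℝ (Set.range (legL2 (d := d))) ≤ (Submodule.span ℝ {f})ᗮ := by
      rw [Submodule.span_le]
      rintro _ ⟨β, rfl⟩
      rw [SetLike.mem_coe, Submodule.mem_orthogonal_singleton_iff_inner_left]
      exact hleg β
    exact (Submodule.mem_orthogonal_singleton_iff_inner_left).1 (hle (polyToL2_mem_span q)))

theorem legHilbertBasis_apply {d : ℕ} (β : Fin d → ℕ) : legHilbertBasis d β = normLeg β := by
  rw [legHilbertBasis, HilbertBasis.coe_mkOfOrthogonalEqBot]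

theorem inner_normLeg_sq {d : ℕ} (β : Fin d → ℕ) (u : L2Cube d) :
    inner ℝ (normLeg β) u ^ 2 = inner ℝ (legL2 β) u ^ 2 / ‖legL2 β‖ ^ 2 := by
  rw [inner_normLeg, mul_pow, inv_pow, inv_mul_eq_div]

/-- The projection error is bounded by any common bound of the finite partial sums of the squared
Legendre coefficients of degree larger than `p`. -/
theorem norm_sub_projP_sq_le {d p : ℕ} (u : L2Cube d) {B : ℝ}
    (h : ∀ F : Finset (Fin d → ℕ), (∀ β ∈ F, p < ∑ k, β k) →
      ∑ β ∈ F, inner ℝ (legL2 β) u ^ 2 / ‖legL2 β‖ ^ 2 ≤ B) :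
    ‖u - projP d p u‖ ^ 2 ≤ B := by
  set y := u - projP d p u with hy
  have hs := (legHilbertBasis d).hasSum_inner_mul_inner y y
  rw [real_inner_self_eq_norm_sq] at hs
  refine hasSum_le_of_sum_le hs fun F => ?_
  -- Above degree `p` the projection has no component along `L_β`; up to degree `p` the error has
  -- none.
  have hterm : ∀ β, inner ℝ y (legHilbertBasis d β) * inner ℝ (legHilbertBasis d β) y =
      if p < ∑ k, β k then inner ℝ (legL2 β) u ^ 2 / ‖legL2 β‖ ^ 2 else 0 := by
    intro β
    rw [legHilbertBasis_apply, real_inner_comm, ← pow_two, inner_normLeg_sq]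
    split_ifs with hβ
    · have hmem : projP d p u ∈ polySpace d p := Submodule.starProjection_apply_mem _ u
      rw [hy, inner_sub_right, inner_legL2_of_mem_polySpace hβ hmem, sub_zero]
    · rw [real_inner_comm, hy, projP, Submodule.starProjection_inner_eq_zero _ _
        (legL2_mem_polySpace (not_lt.1 hβ))]
      simp
  simp only [hterm]
  rw [← Finset.sum_filter]
  exact h _ fun β hβ => (Finset.mem_filter.1 hβ).2

/-- Bessel's inequality for an orthogonal family. -/
theorem sum_inner_sq_div_le {E ι : Type*} [NormedAddCommGroup E] [InnerProductSpace ℝ E]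
    {f : ι → E} (hf : Pairwise fun i j => inner ℝ (f i) (f j) = 0) (x : E) (F : Finset ι) :
    ∑ i ∈ F, inner ℝ (f i) x ^ 2 / ‖f i‖ ^ 2 ≤ ‖x‖ ^ 2 := by
  classical
  set z := ∑ i ∈ F, (inner ℝ (f i) x / ‖f i‖ ^ 2) • f i with hz
  have hzx : inner ℝ z x = ∑ i ∈ F, inner ℝ (f i) x ^ 2 / ‖f i‖ ^ 2 := by
    rw [hz, sum_inner]
    refine Finset.sum_congr rfl fun i _ => ?_
    rw [real_inner_smul_left]
    ring
  have hzz : inner ℝ z z = ∑ i ∈ F, inner ℝ (f i) x ^ 2 / ‖f i‖ ^ 2 := by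
    conv_lhs => rw [hz, sum_inner]
    refine Finset.sum_congr rfl fun i hi => ?_
    rw [inner_sum, Finset.sum_eq_single i]
    · rw [real_inner_smul_left, real_inner_smul_right, real_inner_self_eq_norm_sq]
      -- Zero vectors are allowed, with quotient `0`: `W^α D^α L_β` vanishes when some `β k < α k`.
      rcases eq_or_ne (‖f i‖ ^ 2) 0 with h0 | h0
      · simp [h0]
      · field_simp
    · intro j _ hj
      rw [real_inner_smul_left, real_inner_smul_right, hf hj.symm]
      simp
    · exact fun h => absurd hi h
  have h0 := real_inner_self_nonneg (x := x - z)
  rw [inner_sub_left, inner_sub_right, inner_sub_right, real_inner_comm z x, hzx, hzz,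
    real_inner_self_eq_norm_sq] at h0
  linarith

end L2Basis

/-! ### Weak derivatives and seminorms -/

section Seminorms

open scoped ContDiff

/-- The fundamental lemma of the calculus of variations. It transfers square integrability from any
weak derivative to the chosen one, `weakDeriv`. -/
theorem IsWeakDeriv.ae_eq {d : ℕ} {α : Fin d → ℕ} {u v w : (Fin d → ℝ) → ℝ}
    (hv : IsWeakDeriv α u v) (hw : IsWeakDeriv α u w) : v =ᵐ[cubeMeasure d] w := by
  have key : ∀ᵐ x ∂(volume : Measure (Fin d → ℝ)),
      x ∈ (cube d : Set (Fin d → ℝ)) → (v - w) x = 0 := by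
    refine (cube d).isOpen.ae_eq_zero_of_integral_contDiff_smul_eq_zero
      (hv.locallyIntegrableOn_right.sub hw.locallyIntegrableOn_right) ?_
    intro g hg hgc hgs
    set φ : TestFunction (cube d) ℝ ⊤ := ⟨g, hg, hgc, hgs⟩ with hφ
    have hφg : ∀ x, φ x = g x := fun x => rfl
    have e := (hv.integral_eq φ).symm.trans (hw.integral_eq φ)
    have e' := mul_left_cancel₀ (pow_ne_zero _ (by norm_num : (-1 : ℝ) ≠ 0)) e
    simp only [hφg] at e'
    have hint : ∀ f : (Fin d → ℝ) → ℝ, LocallyIntegrableOn f (cube d : Set (Fin d → ℝ)) volume →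
        IntegrableOn (fun x => f x * g x) (cube d : Set (Fin d → ℝ)) := by
      intro f hf
      have h1 : IntegrableOn (fun x => f x * g x) (tsupport g) := by
        exact (hf.integrableOn_compact_subset hgs hgc).mul_continuousOn
          hg.continuous.continuousOn hgc
      refine (h1.integrable_of_forall_notMem_eq_zero fun x hx => ?_).integrableOn
      rw [image_eq_zero_of_notMem_tsupport hx, mul_zero]
    have h0 : ∫ x in (cube d : Set (Fin d → ℝ)), g x • (v - w) x = 0 := by
      have : ∀ x, g x • (v - w) x = v x * g x - w x * g x := fun x => by
        simp only [Pi.sub_apply, smul_eq_mul]; ring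
      simp only [this]
      rw [integral_sub (hint v hv.locallyIntegrableOn_right) (hint w hw.locallyIntegrableOn_right),
        e', sub_self]
    rw [← h0, setIntegral_eq_integral_of_forall_compl_eq_zero]
    intro x hx
    rw [image_eq_zero_of_notMem_tsupport fun h => hx (hgs h), zero_smul]
  filter_upwards [ae_restrict_of_ae key, ae_restrict_mem (measurableSet_cube d)] with x h1 h2
  exact sub_eq_zero.1 (h1 h2)

theorem MemSobolev.isWeakDeriv {d l : ℕ} {u : (Fin d → ℝ) → ℝ} (h : MemSobolev l u)
    {α : Fin d → ℕ} (hα : ∑ k, α k ≤ l) : IsWeakDeriv α u (weakDeriv α u) := by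
  obtain ⟨v, hv, -⟩ := h.2 α hα
  have hex : ∃ v, IsWeakDeriv α u v := ⟨v, hv⟩
  rw [weakDeriv, dif_pos hex]
  exact hex.choose_spec

theorem MemSobolev.memLp_weakDeriv {d l : ℕ} {u : (Fin d → ℝ) → ℝ} (h : MemSobolev l u)
    {α : Fin d → ℕ} (hα : ∑ k, α k ≤ l) : MemLp (weakDeriv α u) 2 (cubeMeasure d) := by
  obtain ⟨v, hv, hv2⟩ := h.2 α hα
  exact (memLp_congr_ae ((h.isWeakDeriv hα).ae_eq hv)).2 hv2

theorem continuous_weight {d : ℕ} (α : Fin d → ℕ) : Continuous (weight α) := by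
  unfold weight
  fun_prop

theorem abs_weight_le_one {d : ℕ} (α : Fin d → ℕ) (x : Fin d → ℝ) : |weight α x| ≤ 1 := by
  rw [weight, Finset.abs_prod]
  refine Finset.prod_le_one (fun _ _ => abs_nonneg _) fun k _ => ?_
  rw [abs_of_nonneg (by positivity)]
  exact pow_le_one₀ (Real.sqrt_nonneg _) (Real.sqrt_le_one.2 (by linarith [sq_nonneg (x k)]))

theorem weight_mul_weight {d : ℕ} (α : Fin d → ℕ) {x : Fin d → ℝ}
    (hx : x ∈ (cube d : Set (Fin d → ℝ))) :
    weight α x * weight α x = ∏ k, (wt ^ α k).eval (x k) := by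
  rw [weight, ← Finset.prod_mul_distrib]
  refine Finset.prod_congr rfl fun k _ => ?_
  have hk := hx k (Set.mem_univ k)
  rw [← mul_pow, Real.mul_self_sqrt (by nlinarith [hk.1, hk.2])]
  simp [wt]

theorem memLp_weight_mul {d : ℕ} (α : Fin d → ℕ) {f : (Fin d → ℝ) → ℝ}
    (hf : MemLp f 2 (cubeMeasure d)) : MemLp (fun x => weight α x * f x) 2 (cubeMeasure d) := by
  refine hf.mono ((continuous_weight α).aestronglyMeasurable.mul hf.aestronglyMeasurable)
    (Filter.Eventually.of_forall fun x => ?_)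
  rw [norm_mul]
  exact mul_le_of_le_one_left (norm_nonneg _) (abs_weight_le_one α x)

theorem sq_norm_toLp {X : Type*} [MeasurableSpace X] {μ : Measure X} {f : X → ℝ}
    (hf : MemLp f 2 μ) : ‖hf.toLp f‖ ^ 2 = ∫ x, f x ^ 2 ∂μ := by
  rw [← real_inner_self_eq_norm_sq, inner_toLp]
  simp only [pow_two]

theorem seminormV_sq {d : ℕ} (s : ℕ) (u : (Fin d → ℝ) → ℝ) :
    seminormV s u ^ 2 = ∑ α ∈ (Finset.univ : Finset (Fin d)).piAntidiag s,
      ∫ x in (cube d : Set (Fin d → ℝ)), (weight α x * weakDeriv α u x) ^ 2 :=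
  Real.sq_sqrt (Finset.sum_nonneg fun _ _ => integral_nonneg fun _ => sq_nonneg _)

theorem seminormH_sq {d : ℕ} (s : ℕ) (u : (Fin d → ℝ) → ℝ) :
    seminormH s u ^ 2 = ∑ α ∈ (Finset.univ : Finset (Fin d)).piAntidiag s,
      ∫ x in (cube d : Set (Fin d → ℝ)), weakDeriv α u x ^ 2 :=
  Real.sq_sqrt (Finset.sum_nonneg fun _ _ => integral_nonneg fun _ => sq_nonneg _)

theorem seminormV_sq_le {d l s : ℕ} (hs : s ≤ l) {u : (Fin d → ℝ) → ℝ} (h : MemSobolev l u) :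
    seminormV s u ^ 2 ≤ seminormH s u ^ 2 := by
  rw [seminormV_sq, seminormH_sq]
  refine Finset.sum_le_sum fun α hα => ?_
  have hα' : ∑ k, α k ≤ l := by
    rw [(Finset.mem_piAntidiag.1 hα).1]; exact hs
  have hL := h.memLp_weakDeriv hα'
  refine integral_mono (memLp_weight_mul α hL).integrable_sq hL.integrable_sq fun x => ?_
  simp only [mul_pow]
  refine mul_le_of_le_one_left (sq_nonneg _) ?_
  rw [← sq_abs]
  exact pow_le_one₀ (abs_nonneg _) (abs_weight_le_one α x)

/-- Bessel's inequality for a weighted weak derivative, in terms of the Legendre coefficients. -/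
theorem sum_factQuot_mul_le {d l : ℕ} {u : L2Cube d} (h : MemSobolev l u) {α : Fin d → ℕ}
    (hα : ∑ k, α k ≤ l) (F : Finset (Fin d → ℕ)) :
    ∑ β ∈ F, (∏ k, (factQuot (β k) (α k) : ℝ)) * (inner ℝ (legL2 β) u ^ 2 / ‖legL2 β‖ ^ 2) ≤
      ∫ x in (cube d : Set (Fin d → ℝ)), (weight α x * weakDeriv α u x) ^ 2 := by
  set v := weakDeriv α (u : (Fin d → ℝ) → ℝ) with hv
  have hvL : MemLp v 2 (cubeMeasure d) := h.memLp_weakDeriv hα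
  have hV := memLp_weight_mul α hvL
  set D : (Fin d → ℕ) → Fin d → Polynomial ℝ :=
    fun β k => Polynomial.derivative^[α k] (leg (β k)) with hD
  have hq : ∀ β, MemLp (fun x => weight α x * MvPolynomial.eval x (prodPoly (D β))) 2
      (cubeMeasure d) := fun β => memLp_weight_mul α (memLp_polynomial _)
  set f : (Fin d → ℕ) → L2Cube d := fun β => (hq β).toLp _ with hf
  have hww : ∀ {g g' : (Fin d → ℝ) → ℝ},
      ∫ x in (cube d : Set (Fin d → ℝ)), (weight α x * g x) * (weight α x * g' x) =
        ∫ x in (cube d : Set (Fin d → ℝ)), (∏ k, (wt ^ α k).eval (x k)) * g x * g' x := by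
    intro g g'
    refine setIntegral_congr_fun (measurableSet_cube d) fun x hx => ?_
    rw [← weight_mul_weight α hx]
    ring
  have hff : ∀ β γ, inner ℝ (f β) (f γ) =
      (∏ k, (factQuot (β k) (α k) : ℝ)) * inner ℝ (legL2 β) (legL2 γ) := by
    intro β γ
    simp only [hf]
    rw [inner_toLp, hww, legL2, legL2, inner_prodPoly, ← Finset.prod_mul_distrib]
    simp only [eval_prodPoly, ← Finset.prod_mul_distrib, ← Polynomial.eval_mul]
    rw [integral_prodPoly]
    exact Finset.prod_congr rfl fun k _ => intPoly_weighted_leg _ _ _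
  have hfV : ∀ β, inner ℝ (f β) (hV.toLp _) =
      (∏ k, (factQuot (β k) (α k) : ℝ)) * inner ℝ (legL2 β) u := by
    intro β
    have hu : IntegrableOn u (cube d : Set (Fin d → ℝ)) := h.1.integrable one_le_two
    -- By the Sturm–Liouville identity, the `α`-derivative of the test polynomial is a multiple of
    -- `L_β`; its sign `(-1)^{|α|}` cancels the one from integration by parts.
    have hw := (h.isWeakDeriv hα).integral_polynomial hu (hvL.integrable one_le_two) (D β)
    simp only [hD, iterate_derivative_wt_pow_leg, Polynomial.eval_mul, Polynomial.eval_C,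
      Finset.prod_mul_distrib, Finset.prod_pow_eq_pow_sum] at hw
    simp only [hf]
    rw [inner_toLp, hww, legL2, inner_polyToL2_Lp]
    simp only [eval_prodPoly, hD]
    have e1 : ∀ x : Fin d → ℝ, (∏ k, (wt ^ α k).eval (x k)) *
        (∏ k, (Polynomial.derivative^[α k] (leg (β k))).eval (x k)) * v x =
        v x * ((∏ k, (wt ^ α k).eval (x k)) *
        (∏ k, (Polynomial.derivative^[α k] (leg (β k))).eval (x k))) := fun x => mul_comm _ _
    simp only [e1]
    have e2 : ∀ x : Fin d → ℝ, u x * ((-1) ^ (∑ k, α k) * (∏ k, (factQuot (β k) (α k) : ℝ)) *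
        ∏ k, (leg (β k)).eval (x k)) = (-1) ^ (∑ k, α k) * ((∏ k, (factQuot (β k) (α k) : ℝ)) *
        (u x * ∏ k, (leg (β k)).eval (x k))) := fun x => by ring
    simp only [e2] at hw
    rw [integral_const_mul, integral_const_mul] at hw
    exact (mul_left_cancel₀ (pow_ne_zero _ (by norm_num : (-1 : ℝ) ≠ 0)) hw).symm
  have horth : Pairwise fun β γ => inner ℝ (f β) (f γ) = 0 := by
    intro β γ hne
    simp only [hff, inner_legL2_of_ne hne, mul_zero]
  have hB := sum_inner_sq_div_le horth (hV.toLp _) F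
  rw [sq_norm_toLp] at hB
  refine le_trans (le_of_eq (Finset.sum_congr rfl fun β _ => ?_)) hB
  rw [hfV, ← real_inner_self_eq_norm_sq (f β), hff, real_inner_self_eq_norm_sq]
  set c := ∏ k, (factQuot (β k) (α k) : ℝ)
  -- Bessel's quotient is `c² / c` times the Legendre energy; for `c = 0` both sides are `0`.
  rcases eq_or_ne c 0 with h0 | h0
  · simp [h0]
  · have := (norm_legL2_pos β).ne'
    field_simp

end Seminorms

end CubeProj

end

/-! ### Assembly of the error estimate -/

theorem mainTheorem2 :
    ∀ s : ℕ, ∃ C : ℝ, 0 < C ∧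
      ∀ d : ℕ, 1 ≤ d → ∀ p l : ℕ, s ≤ min (p + 1) l →
        ∀ u : CubeProj.L2Cube d, CubeProj.MemSobolev l u →
          ‖u - CubeProj.projP d p u‖ ^ 2 ≤
              CubeProj.Phi d (p + 1) s * CubeProj.seminormV s u ^ 2 ∧
            CubeProj.Phi d (p + 1) s * CubeProj.seminormV s u ^ 2 ≤
              C * ((d : ℝ) / (p + 1)) ^ (2 * s) * CubeProj.seminormH s u ^ 2 := by
  intro s
  refine ⟨s.factorial, by exact_mod_cast s.factorial_pos, fun d hd p l hs u hu => ?_⟩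
  have hsp : s ≤ p + 1 := hs.trans (min_le_left _ _)
  have hsl : s ≤ l := hs.trans (min_le_right _ _)
  have hcast : CubeProj.Phi d ((p : ℝ) + 1) s = CubeProj.Phi d (p + 1 : ℕ) s := by push_cast; rfl
  have hPhi0 := CubeProj.Phi_nonneg (d := d) hsp
  rw [hcast]
  constructor
  · refine CubeProj.norm_sub_projP_sq_le u fun F hF => ?_
    set a : (Fin d → ℕ) → ℝ :=
      fun β => inner ℝ (CubeProj.legL2 β) u ^ 2 / ‖CubeProj.legL2 β‖ ^ 2 with ha
    have ha0 : ∀ β, 0 ≤ a β := fun β => by positivity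
    rw [CubeProj.seminormV_sq]
    calc ∑ β ∈ F, a β
        ≤ ∑ β ∈ F, CubeProj.Phi d (p + 1 : ℕ) s *
          ((∑ α ∈ (Finset.univ : Finset (Fin d)).piAntidiag s,
            ∏ k, (CubeProj.factQuot (β k) (α k) : ℝ)) * a β) := by
          refine Finset.sum_le_sum fun β hβ => ?_
          have hlt : p + 1 ≤ ∑ k, β k := hF β hβ
          -- The strict bound `p < |β|` makes `|β|` at least `p + 1`, hence positive and at least
          -- `s`, even when `s = p + 1`.
          have h1 := CubeProj.one_le_Phi_mul_sum hd β s (by omega) (hsp.trans hlt)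
          have h2 := CubeProj.Phi_antitone (d := d) hsp hlt
          rw [← mul_assoc]
          refine le_mul_of_one_le_left (ha0 β) (h1.trans ?_)
          exact mul_le_mul_of_nonneg_right h2 (by positivity)
      _ = CubeProj.Phi d (p + 1 : ℕ) s * ∑ α ∈ (Finset.univ : Finset (Fin d)).piAntidiag s,
          ∑ β ∈ F, (∏ k, (CubeProj.factQuot (β k) (α k) : ℝ)) * a β := by
          rw [← Finset.mul_sum, Finset.sum_comm]
          simp only [Finset.sum_mul]
      _ ≤ _ := by
          refine mul_le_mul_of_nonneg_left (Finset.sum_le_sum fun α hα => ?_) hPhi0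
          exact CubeProj.sum_factQuot_mul_le hu
            (by rw [(Finset.mem_piAntidiag.1 hα).1]; exact hsl) F
  · have h1 := CubeProj.Phi_le hd hsp
    have h2 := CubeProj.seminormV_sq_le hsl hu
    push_cast at h1 ⊢
    exact mul_le_mul h1 h2 (sq_nonneg _) (by positivity)
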